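/- Let $(R,\mathfrak m,k)$ be a commutative Noetherian local ring. Let $C$ be a semidualizing complex for $R$, that is, a homologically bounded complex of $R$-modules with finitely generated homology modules such that the homothety morphism $R\to\mathbf{R}\mathrm{Hom}_R(C,C)$ is an isomorphism in the derived category $\mathcal D(R)$. For an integer $i$ let $\beta^R_i(C)=\dim_k \mathrm{H}_i(k\otimes^{\mathbf L}_R C)$ denote the $i$-th Betti number of $C$, and let $\sup C=\sup\{i\in\mathbb Z\mid \mathrm H_i(C)\neq 0\}$. Suppose that $\beta^R_n(C)=1$ for some integer $n$, and that at least one of the following conditions holds: - $R$ is Cohen--Macaulay (its depth equals its Krull dimension); - $C$ is a module with a rank, that is, $C$ is isomorphic in $\mathcal D(R)$ to an $R$-module $M$ concentrated in degree $0$ such that $M\otimes_R Q$ is a free $Q$-module of finite rank, where $Q$ is the total ring of fractions of $R$. Then $C\simeq\Sigma^n R$ in $\mathcal D(R)$, and $n=\sup C$. Here $\Sigma^n R$ is the complex with $R$ in homological degree $n$ and $0$ elsewhere. -/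

import Mathlib

open CategoryTheory

universe u w

noncomputable section

namespace SemidualizingBetti

section Existence

open Opposite CochainComplex

/-- In an abelian category with enough projectives, every complex concentrated in cohomological
degrees `≤ b` receives a quasi-isomorphism from such a complex with projective terms. -/
theorem exists_quasiIso_projective {A : Type*} [Category* A] [Abelian A] [EnoughProjectives A]
    (K : CochainComplex A ℤ) (b : ℤ) [K.IsStrictlyLE b] :
    ∃ (P : CochainComplex A ℤ) (π : P ⟶ K), (∀ n : ℤ, Projective (P.X n)) ∧ P.IsStrictlyLE b ∧
      QuasiIso π := by
  let E := opEquivalence A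
  have : (E.functor.obj (op K)).IsStrictlyGE (-b) := by
    rw [isStrictlyGE_iff]
    intro i hi
    exact (K.isZero_of_isStrictlyLE b _ (show b < -i by lia)).op
  obtain ⟨L, i, hi, hL, hLb⟩ :=
    CochainComplex.Plus.modelCategoryQuillen.exists_quasiIso_injective (E.functor.obj (op K)) (-b)
  refine ⟨(E.inverse.obj L).unop, (E.unit.app (op K) ≫ E.inverse.map i).unop, ?_, ?_, ?_⟩
  · intro n
    have := hL (-n)
    exact inferInstanceAs (Projective (L.X (-n)).unop)
  · rw [isStrictlyLE_iff]
    intro n hn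
    exact (L.isZero_of_isStrictlyGE (-b) (-n) (by lia)).unop
  · have h1 : QuasiIso (E.inverse.map i).unop := by
      rw [quasiIso_iff]
      intro n
      rw [quasiIsoAt_iff' _ (n-1) n (n+1) (by simp) (by simp)]
      have h2 := hi.quasiIsoAt (-n)
      rw [quasiIsoAt_iff' _ (-(n+1)) (-n) (-(n-1)) (by simp; lia) (by simp;lia)] at h2
      exact ShortComplex.quasiIso_unopMap ((HomologicalComplex.shortComplexFunctor' Aᵒᵖ (ComplexShape.up ℤ) (-(n+1)) (-n) (-(n-1))).map i)
    rw [unop_comp]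
    infer_instance

end Existence

variable {R : Type u} [CommRing R]

/-! ### Complexes of modules

Complexes of `R`-modules are indexed cohomologically, as in Mathlib, so the homology module which
is classically denoted `H_i(X)` is `X.homology (-i)`, and the classical shift `Σ^n X`, with
`(Σ^n X)_i = X_{i-n}`, is `X⟦n⟧`. -/

/-- The homology module `H_i(X)`, in homological indexing. -/
abbrev lowerHomology (X : CochainComplex (ModuleCat.{u} R) ℤ) (i : ℤ) : ModuleCat.{u} R :=
  X.homology (-i)

/-- The supremum `sup X = sup {i ∈ ℤ | H_i(X) ≠ 0}`, an element of `ℤ ∪ {-∞, ∞}`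
(with `sup ∅ = -∞`). -/
def complexSup (X : CochainComplex (ModuleCat.{u} R) ℤ) : WithBot (WithTop ℤ) :=
  sSup {s | ∃ i : ℤ, ¬ Limits.IsZero (lowerHomology X i) ∧ s = ((i : WithTop ℤ) : WithBot _)}

/-- `X` is homologically bounded: its homology vanishes outside a bounded interval. -/
class IsHomologicallyBounded (X : CochainComplex (ModuleCat.{u} R) ℤ) : Prop where
  exists_isGE : ∃ a : ℤ, X.IsGE a
  exists_isLE : ∃ b : ℤ, X.IsLE b

/-- A projective resolution of a complex `X`: a quasi-isomorphism `P ⟶ X` where `P` is a complex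
of projective modules which vanishes in all sufficiently small homological degrees (that is, in
all sufficiently large cohomological degrees). -/
structure ComplexProjectiveResolution (X : CochainComplex (ModuleCat.{u} R) ℤ) where
  /-- the resolving complex -/
  P : CochainComplex (ModuleCat.{u} R) ℤ
  /-- the augmentation -/
  π : P ⟶ X
  projective : ∀ n : ℤ, Projective (P.X n)
  exists_isStrictlyLE : ∃ b : ℤ, P.IsStrictlyLE b
  quasiIso : QuasiIso π

/-- Homologically bounded complexes have projective resolutions. -/
theorem nonempty_complexProjectiveResolution (X : CochainComplex (ModuleCat.{u} R) ℤ)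
    [IsHomologicallyBounded X] : Nonempty (ComplexProjectiveResolution X) := by
  obtain ⟨b, hb⟩ := IsHomologicallyBounded.exists_isLE (X := X)
  obtain ⟨P, π, hP, hPb, hπ⟩ := exists_quasiIso_projective (X.truncLE b) b
  exact ⟨⟨P, π ≫ X.ιTruncLE b, hP, ⟨b, hPb⟩, inferInstance⟩⟩

/-- A chosen projective resolution (it is unique up to homotopy equivalence). -/
def projRes (X : CochainComplex (ModuleCat.{u} R) ℤ) [IsHomologicallyBounded X] :
    ComplexProjectiveResolution X :=
  Classical.choice (nonempty_complexProjectiveResolution X)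

/-! ### Derived Hom and the homothety morphism -/

section Hom

open CochainComplex HomComplex

/-- The complex of `R`-modules `Hom_R(X, Y)`, whose term in cohomological degree `n` consists of
the families of linear maps `X^p ⟶ Y^{p+n}`. -/
def homComplex (X Y : CochainComplex (ModuleCat.{u} R) ℤ) : CochainComplex (ModuleCat.{u} R) ℤ where
  X n := ModuleCat.of R (Cochain X Y n)
  d i j := ModuleCat.ofHom (δ_hom R X Y i j)
  shape _ _ hij := by ext : 2; exact δ_shape _ _ hij _
  d_comp_d' _ _ _ _ _ := by ext; simp [δ_δ]

/-- The derived Hom complex `RHom_R(X, Y)`, computed as `Hom_R(P, Y)` for a projective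
resolution `P` of `X`. -/
def rHom (X Y : CochainComplex (ModuleCat.{u} R) ℤ) [IsHomologicallyBounded X] :
    CochainComplex (ModuleCat.{u} R) ℤ :=
  homComplex (projRes X).P Y

/-- The ring `R` as a complex concentrated in degree zero. -/
abbrev ringComplex (R : Type u) [CommRing R] : CochainComplex (ModuleCat.{u} R) ℤ :=
  (HomologicalComplex.single (ModuleCat.{u} R) (ComplexShape.up ℤ) 0).obj (ModuleCat.of R R)

/-- The homothety morphism `R ⟶ RHom_R(X, X)`. Under the identification of `RHom_R(X, X)` with
`Hom_R(P, X)`, for `π : P ⟶ X` a projective resolution, it sends `r` to `r • π`, which is the image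
of the multiplication by `r` on `X`. -/
def homothety (X : CochainComplex (ModuleCat.{u} R) ℤ) [IsHomologicallyBounded X] :
    ringComplex R ⟶ rHom X X :=
  HomologicalComplex.mkHomFromSingle
    (ModuleCat.ofHom (LinearMap.toSpanSingleton R (Cochain (projRes X).P X 0)
      (Cochain.ofHom (projRes X).π)))
    (fun k _ => by
      ext
      change δ 0 k ((1 : R) • Cochain.ofHom (projRes X).π) = 0
      rw [one_smul, δ_ofHom])

end Hom

/-- A semidualizing complex: a homologically bounded complex with finitely generated homology
modules such that the homothety morphism `R ⟶ RHom_R(C, C)` is an isomorphism in the derived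
category, that is, a quasi-isomorphism. -/
structure IsSemidualizing (C : CochainComplex (ModuleCat.{u} R) ℤ) [IsHomologicallyBounded C] :
    Prop where
  finite_homology : ∀ i : ℤ, Module.Finite R (lowerHomology C i)
  quasiIso_homothety : QuasiIso (homothety C)

/-! ### Betti numbers -/

section Betti

open IsLocalRing

instance additive_extendScalars {S : Type u} [CommRing S] (f : R →+* S) :
    (ModuleCat.extendScalars.{u, u, u} f).Additive :=
  (ModuleCat.extendRestrictScalarsAdj f).left_adjoint_additive

variable [IsLocalRing R]

/-- The derived tensor product `k ⊗ᴸ_R X` with the residue field `k` of `R`, as a complex of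
`k`-vector spaces: it is computed as `k ⊗_R P` for a projective resolution `P` of `X`. -/
def residueTensor (X : CochainComplex (ModuleCat.{u} R) ℤ) [IsHomologicallyBounded X] :
    CochainComplex (ModuleCat.{u} (ResidueField R)) ℤ :=
  ((ModuleCat.extendScalars.{u, u, u} (residue R)).mapHomologicalComplex (ComplexShape.up ℤ)).obj
    (projRes X).P

/-- The `n`-th Betti number `β_n(X)`: the rank of the `k`-vector space
`Tor_n(k, X) = H_n(k ⊗ᴸ_R X)`. -/
def betti (X : CochainComplex (ModuleCat.{u} R) ℤ) [IsHomologicallyBounded X] (n : ℤ) : ℕ :=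
  Module.finrank (ResidueField R) ((residueTensor X).homology (-n))

end Betti

/-! ### Cohen-Macaulay rings and modules with a rank -/

/-- The depth of a local ring with residue field `k`: `inf {i | Ext^i_R(k, R) ≠ 0}`. -/
def ringDepth (R : Type u) [CommRing R] [IsLocalRing R] : ℕ∞ :=
  ⨅ i ∈ {i : ℕ | Nontrivial (Abelian.Ext (ModuleCat.of R (IsLocalRing.ResidueField R))
    (ModuleCat.of R R) i)}, (i : ℕ∞)

/-- A local ring is Cohen-Macaulay if its depth equals its Krull dimension. -/
def IsCohenMacaulayLocal (R : Type u) [CommRing R] [IsLocalRing R] : Prop :=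
  (ringDepth R : WithBot ℕ∞) = ringKrullDim R

/-- The module `M` has a rank: for some `r`, its base change to the total ring of fractions `Q`
of `R` is a free `Q`-module of rank `r`. -/
def HasRank (R : Type u) [CommRing R] (M : Type u) [AddCommGroup M] [Module R M] : Prop :=
  ∃ r : ℕ, Nonempty
    (TensorProduct R (FractionRing R) M ≃ₗ[FractionRing R] (Fin r → FractionRing R))

end SemidualizingBetti

end

/-!
Write `C` for the semidualizing complex and `F → C` for its minimal free resolution, so that the
Betti numbers are the ranks of the terms of `F`. The proof reduces to a statement about modules and
then shows that no rank `1` can occur in a positive degree of a minimal resolution.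

*Homothety.* That `R → RHom(C, C)` is a quasi-isomorphism means that all morphisms from `C` to a
nonzero shift of `C` vanish in the derived category and that every endomorphism of `C` is the
multiplication by a unique element of `R` (`IsSemidualizing.shiftedHom_eq_zero`,
`IsSemidualizing.endEquiv`).

*Reduction to modules.* Over a Cohen-Macaulay ring, `C` is a shift of a module. Indeed, let `rs`
be a regular sequence generating an ideal primary to the maximal ideal and `t` the top degree with
`H^t(C) ≠ 0`. Replacing the second argument of `Hom(C, C)` by iterated cones of the elements of
`rs`, one is reduced to an object `Y` with cohomology of finite length, such that all morphisms
from nonzero shifts of `C` to `Y` vanish. If the lowest cohomology of `Y` were in degree `u ≠ t`,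
there would be a nonzero map `H^t(C) → k → H^u(Y)`, which lifts to a nonzero morphism from a shift
of `C` to `Y`. Nakayama's lemma lifts the vanishing of `H^j(Y)` for `j < t` back to `C`
(`cohomology_of_isWeaklyRegular`, `IsSemidualizing.exists_iso_shift_of_isWeaklyRegular`); the same
induction shows that `rs` is regular on the module.

*Modules.* So let `C` be a shift of a module `M`, with minimal free resolution `F → M`. Then the
complex `0 → R → Hom(F₀, M) → Hom(F₁, M) → ⋯` is exact.

If `R` is Cohen-Macaulay, this sequence and the resolution stay exact modulo `rs`, and their terms
get finite length. The lengths of the images of the differentials of the two sequences obey the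
same recursion with the roles of `R` and `M` exchanged; if a free module of rank one occurs in a
positive degree, minimality and arithmetic exclude all possible values
(`finrank_ne_one_of_isArtinian_quotient`, `false_of_length_relations`).

If `M` has a rank, the syzygies become projective of constant rank over the total ring of
fractions, so a free module of rank one in a positive degree forces an adjacent differential to
vanish, which contradicts the minimality of `F` or the exactness of its dual
(`finrank_ne_one_of_hasRank`).

Hence the Betti number one is that of `F₀`, so `M` is cyclic; it is also faithful, as
multiplication by `r ≠ 0` is not zero on `M`, and so `M ≅ R`.
-/

noncomputable section

namespace SemidualizingBetti

/-! ### Reduction modulo a regular sequence and a count of lengths -/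

section RegularReduction

open RingTheory.Sequence Function

variable {R : Type*} [CommRing R]

/-- The reduction `N / I N` of a module modulo an ideal. -/
abbrev ModIdeal (I : Ideal R) (N : Type*) [AddCommGroup N] [Module R N] : Type _ :=
  N ⧸ (I • (⊤ : Submodule R N))

/-- The map `N / I N → N' / I N'` induced by a linear map `N → N'`. -/
abbrev modIdealMap (I : Ideal R) {N N' : Type*} [AddCommGroup N] [Module R N] [AddCommGroup N']
    [Module R N'] (f : N →ₗ[R] N') : ModIdeal I N →ₗ[R] ModIdeal I N' :=
  Submodule.mapQ _ _ f (Submodule.smul_top_le_comap_smul_top I f)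

section

variable {N₁ N₂ N₃ : Type*} [AddCommGroup N₁] [Module R N₁] [AddCommGroup N₂] [Module R N₂]
  [AddCommGroup N₃] [Module R N₃]

lemma modIdealMap_surjective (I : Ideal R) {f : N₁ →ₗ[R] N₂} (hf : Surjective f) :
    Surjective (modIdealMap I f) := by
  intro y
  obtain ⟨y, rfl⟩ := Submodule.mkQ_surjective _ y
  obtain ⟨x, rfl⟩ := hf y
  exact ⟨Submodule.mkQ _ x, rfl⟩

lemma modIdealMap_exact_nil {f : N₁ →ₗ[R] N₂} {g : N₂ →ₗ[R] N₃} (h : Exact f g) :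
    Exact (modIdealMap (Ideal.ofList []) f) (modIdealMap (Ideal.ofList []) g) := by
  apply (Exact.iff_of_ladder_linearEquiv ?_ ?_).mp h
  any_goals exact Submodule.quotEquivOfEqBot _ <|
    Eq.trans (congrArg (· • ⊤) Ideal.ofList_nil) (Submodule.bot_smul ⊤)
  all_goals exact Submodule.quot_hom_ext _ _ _ fun _ => rfl

/-- Reduction modulo `r :: rs` can be done in two steps. -/
lemma modIdealMap_exact_cons {r : R} {rs : List R} {f : N₁ →ₗ[R] N₂} {g : N₂ →ₗ[R] N₃}
    (h : Exact (modIdealMap (Ideal.ofList rs) (QuotSMulTop.map r f))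
      (modIdealMap (Ideal.ofList rs) (QuotSMulTop.map r g))) :
    Exact (modIdealMap (Ideal.ofList (r :: rs)) f) (modIdealMap (Ideal.ofList (r :: rs)) g) :=
  (Exact.iff_of_ladder_linearEquiv
    (Submodule.quotOfListConsSMulTopEquivQuotSMulTopInner_naturality r rs f).symm
    (Submodule.quotOfListConsSMulTopEquivQuotSMulTopInner_naturality r rs g).symm).mp h

lemma modIdealMap_injective_of_exact_zero {I : Ideal R} {f : N₁ →ₗ[R] N₂}
    (h : Exact (modIdealMap I (0 : PUnit.{1} →ₗ[R] N₁)) (modIdealMap I f)) :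
    Injective (modIdealMap I f) := by
  rw [injective_iff_map_eq_zero]
  intro x hx
  obtain ⟨y, rfl⟩ := (h x).1 hx
  obtain ⟨y, rfl⟩ := Submodule.mkQ_surjective _ y
  simp [modIdealMap]

end

/-- Reducing an exact sequence `⋯ → K₂ → K₁ → K₀ → N → 0` modulo a sequence which is weakly
regular on all its terms preserves exactness. -/
theorem exact_modIdealMap_descending (rs : List R) {K : ℕ → Type*} {N : Type*}
    [∀ i, AddCommGroup (K i)] [∀ i, Module R (K i)] [AddCommGroup N] [Module R N]
    (d : ∀ i, K (i + 1) →ₗ[R] K i) (ε : K 0 →ₗ[R] N)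
    (hK : ∀ i, IsWeaklyRegular (K i) rs) (hN : IsWeaklyRegular N rs)
    (hε : Surjective ε) (h₀ : Exact (d 0) ε) (hd : ∀ i, Exact (d (i + 1)) (d i)) :
    Exact (modIdealMap (Ideal.ofList rs) (d 0)) (modIdealMap (Ideal.ofList rs) ε) ∧
      ∀ i, Exact (modIdealMap (Ideal.ofList rs) (d (i + 1)))
        (modIdealMap (Ideal.ofList rs) (d i)) := by
  induction rs generalizing K N with
  | nil => exact ⟨modIdealMap_exact_nil h₀, fun i => modIdealMap_exact_nil (hd i)⟩
  | cons r rs ih =>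
    have hd' (i : ℕ) : Exact (QuotSMulTop.map r (d (i + 1))) (QuotSMulTop.map r (d i)) := by
      cases i with
      | zero =>
        exact QuotSMulTop.map_first_exact_on_four_term_exact_of_isSMulRegular_last (hd 0) h₀
          ((isWeaklyRegular_cons_iff _ _ _).1 hN).1
      | succ i =>
        exact QuotSMulTop.map_first_exact_on_four_term_exact_of_isSMulRegular_last
          (hd (i + 1)) (hd i) ((isWeaklyRegular_cons_iff _ _ _).1 (hK i)).1
    have h := ih (K := fun i => QuotSMulTop r (K i)) (fun i => QuotSMulTop.map r (d i))
      (QuotSMulTop.map r ε) (fun i => ((isWeaklyRegular_cons_iff _ _ _).1 (hK i)).2)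
      ((isWeaklyRegular_cons_iff _ _ _).1 hN).2 (QuotSMulTop.map_surjective r hε)
      (QuotSMulTop.map_exact r h₀ hε) hd'
    exact ⟨modIdealMap_exact_cons h.1, fun i => modIdealMap_exact_cons (h.2 i)⟩

/-- Reducing an exact sequence `0 → N → K₀ → K₁ → ⋯` modulo a sequence which is weakly
regular on all the `Kᵢ` preserves exactness. -/
theorem exact_modIdealMap_ascending (rs : List R) {K : ℕ → Type*} {N : Type*}
    [∀ i, AddCommGroup (K i)] [∀ i, Module R (K i)] [AddCommGroup N] [Module R N]
    (d : ∀ i, K i →ₗ[R] K (i + 1)) (η : N →ₗ[R] K 0)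
    (hK : ∀ i, IsWeaklyRegular (K i) rs)
    (hη : Injective η) (h₀ : Exact η (d 0)) (hd : ∀ i, Exact (d i) (d (i + 1))) :
    Injective (modIdealMap (Ideal.ofList rs) η) ∧
      Exact (modIdealMap (Ideal.ofList rs) η) (modIdealMap (Ideal.ofList rs) (d 0)) ∧
      ∀ i, Exact (modIdealMap (Ideal.ofList rs) (d i))
        (modIdealMap (Ideal.ofList rs) (d (i + 1))) := by
  -- Injectivity is exactness at one more spot, so that the induction treats it uniformly.
  have hη' := (LinearMap.exact_zero_iff_injective PUnit.{1} η).2 hη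
  suffices Exact (modIdealMap (Ideal.ofList rs) (0 : PUnit.{1} →ₗ[R] N))
      (modIdealMap (Ideal.ofList rs) η) ∧
      Exact (modIdealMap (Ideal.ofList rs) η) (modIdealMap (Ideal.ofList rs) (d 0)) ∧
      ∀ i, Exact (modIdealMap (Ideal.ofList rs) (d i))
        (modIdealMap (Ideal.ofList rs) (d (i + 1))) from
    ⟨modIdealMap_injective_of_exact_zero this.1, this.2⟩
  induction rs generalizing K N with
  | nil =>
    exact ⟨modIdealMap_exact_nil hη', modIdealMap_exact_nil h₀,
      fun i => modIdealMap_exact_nil (hd i)⟩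
  | cons r rs ih =>
    have hr i := (isWeaklyRegular_cons_iff _ _ _).1 (hK i)
    have e₀ : Exact (QuotSMulTop.map r (0 : PUnit.{1} →ₗ[R] N)) (QuotSMulTop.map r η) :=
      QuotSMulTop.map_first_exact_on_four_term_exact_of_isSMulRegular_last hη' h₀ (hr 1).1
    have e₁ : Injective (QuotSMulTop.map r η) := by
      rw [injective_iff_map_eq_zero]
      intro x hx
      obtain ⟨y, rfl⟩ := (e₀ x).1 hx
      simp
    have h := ih (K := fun i => QuotSMulTop r (K i)) (fun i => QuotSMulTop.map r (d i))
      (QuotSMulTop.map r η) (fun i => (hr i).2) e₁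
      (QuotSMulTop.map_first_exact_on_four_term_exact_of_isSMulRegular_last h₀ (hd 0) (hr 2).1)
      (fun i => QuotSMulTop.map_first_exact_on_four_term_exact_of_isSMulRegular_last
        (hd i) (hd (i + 1)) (hr (i + 3)).1)
      ((LinearMap.exact_zero_iff_injective PUnit.{1} _).2 e₁)
    refine ⟨?_, modIdealMap_exact_cons h.2.1, fun i => modIdealMap_exact_cons (h.2.2 i)⟩
    apply modIdealMap_exact_cons
    convert h.1 using 2
    simp

lemma isWeaklyRegular_pi {ι : Type*} [Finite ι] {N : Type*} [AddCommGroup N] [Module R N]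
    {rs : List R} (h : IsWeaklyRegular N rs) : IsWeaklyRegular (ι → N) rs := by
  classical
  have := Fintype.ofFinite ι
  exact ((TensorProduct.piScalarRight R R N ι).isWeaklyRegular_congr rs).1
    h.isWeaklyRegular_rTensor

open TensorProduct in
lemma length_modIdeal_pi (I : Ideal R) (ι : Type*) [Fintype ι] (N : Type*) [AddCommGroup N]
    [Module R N] : Module.length R (ModIdeal I (ι → N)) =
      Fintype.card ι * Module.length R (ModIdeal I N) := by
  classical
  rw [← (quotTensorEquivQuotSMul N I).length_eq, ← (quotTensorEquivQuotSMul (ι → N) I).length_eq,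
    (TensorProduct.piRight R R (R ⧸ I) (fun _ : ι => N)).length_eq, Module.length_pi_of_fintype]
  simp

end RegularReduction

section Counting

variable {R : Type*} [CommRing R]

lemma length_eq_range_add_range {N₁ N₂ N₃ : Type*} [AddCommGroup N₁] [Module R N₁]
    [AddCommGroup N₂] [Module R N₂] [AddCommGroup N₃] [Module R N₃] {f : N₁ →ₗ[R] N₂}
    {g : N₂ →ₗ[R] N₃} (h : Function.Exact f g) :
    Module.length R N₂ = Module.length R (LinearMap.range f) +
      Module.length R (LinearMap.range g) := by
  refine Module.length_eq_add_of_exact (LinearMap.range f).subtype g.rangeRestrict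
    (Submodule.subtype_injective _) g.surjective_rangeRestrict ?_
  intro x
  rw [← LinearMap.mem_ker, LinearMap.ker_rangeRestrict, LinearMap.mem_ker, h x]
  simp

/-- The arithmetic behind the Cohen-Macaulay case. The relations give
`(z n, w n) = ± (m - a r, r - a m)` for some integer `a`, and each value of `a` is incompatible
with `0 < z n ≤ r` and `0 ≤ w n < m`. -/
lemma false_of_length_relations {z w b : ℕ → ℕ} {m r n : ℕ} (hz₀ : z 0 = m) (hw₀ : w 0 = r)
    (hz : ∀ i, z i + z (i + 1) = b i * r) (hw : ∀ i, w i + w (i + 1) = b i * m)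
    (hb : b n = 1) (hzn : 0 < z n) (hwn : w n < m) : False := by
  have key : ∀ i, ∃ a : ℤ, ((z i : ℤ) = m - a * r ∧ (w i : ℤ) = r - a * m) ∨
      ((z i : ℤ) = a * r - m ∧ (w i : ℤ) = a * m - r) := by
    intro i
    induction i with
    | zero => exact ⟨0, Or.inl (by simp [hz₀, hw₀])⟩
    | succ i ih =>
      have h₁ : (z i : ℤ) + z (i + 1) = b i * r := by exact_mod_cast hz i
      have h₂ : (w i : ℤ) + w (i + 1) = b i * m := by exact_mod_cast hw i
      obtain ⟨a, ⟨h₃, h₄⟩ | ⟨h₃, h₄⟩⟩ := ih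
      · exact ⟨a + b i, Or.inr ⟨by linarith, by linarith⟩⟩
      · exact ⟨a - b i, Or.inl ⟨by linarith, by linarith⟩⟩
  have hzr : (z n : ℤ) ≤ r := by
    have := hz n
    rw [hb, one_mul] at this
    exact_mod_cast (show z n ≤ r by omega)
  have hz' : (0 : ℤ) < z n := by exact_mod_cast hzn
  have hw' : (w n : ℤ) < m := by exact_mod_cast hwn
  have hw'' : (0 : ℤ) ≤ w n := by positivity
  obtain ⟨a, ⟨h₁, h₂⟩ | ⟨h₁, h₂⟩⟩ := key n
  · rcases lt_trichotomy a 0 with ha | ha | ha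
    · nlinarith
    · subst ha; linarith
    · nlinarith
  · rcases lt_trichotomy a 1 with ha | ha | ha
    · nlinarith
    · subst ha; linarith
    · nlinarith

end Counting

/-! ### Ranks in a minimal resolution: the Cohen-Macaulay case -/

section ArtinianReduction

open RingTheory.Sequence Function IsLocalRing

variable {R : Type*} [CommRing R]

/-- Reduction modulo `I` is compatible with linear equivalences. -/
def modIdealEquiv (I : Ideal R) {N N' : Type*} [AddCommGroup N] [Module R N] [AddCommGroup N']
    [Module R N'] (e : N ≃ₗ[R] N') : ModIdeal I N ≃ₗ[R] ModIdeal I N' :=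
  LinearEquiv.ofLinearMap (modIdealMap I e.toLinearMap) (modIdealMap I e.symm.toLinearMap)
    (Submodule.linearMap_qext _ (by ext; simp)) (Submodule.linearMap_qext _ (by ext; simp))

lemma modIdeal_finite_length {I : Ideal R} [IsNoetherianRing R] [IsArtinianRing (R ⧸ I)]
    (N : Type*) [AddCommGroup N] [Module R N] [Module.Finite R N] :
    IsArtinian R (ModIdeal I N) ∧ IsNoetherian R (ModIdeal I N) := by
  refine ⟨?_, inferInstance⟩
  have : Module.Finite (R ⧸ I) (ModIdeal I N) :=
    Module.Finite.of_restrictScalars_finite R (R ⧸ I) (ModIdeal I N)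
  have h : IsArtinian (R ⧸ I) (ModIdeal I N) := inferInstance
  have hlen := Module.length_eq_of_surjective (R := R ⧸ I) (S := R) (M := ModIdeal I N)
    Ideal.Quotient.mk_surjective
  have hfin := (Module.length_ne_top_iff.1
    (hlen.trans_ne (Module.length_ne_top (R := R ⧸ I) (M := ModIdeal I N))))
  exact (isFiniteLength_iff_isNoetherian_isArtinian.1 hfin).2

variable [IsLocalRing R]

lemma isWeaklyRegular_of_free {F : Type*} [AddCommGroup F] [Module R F]
    [Module.Free R F] [Module.Finite R F] {rs : List R} (h : IsWeaklyRegular R rs) :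
    IsWeaklyRegular F rs :=
  ((Module.finBasis R F).equivFun.isWeaklyRegular_congr rs).2 (isWeaklyRegular_pi h)

lemma isWeaklyRegular_linearMap_of_free {F : Type*} [AddCommGroup F] [Module R F]
    [Module.Free R F] [Module.Finite R F] {M : Type*} [AddCommGroup M] [Module R M]
    {rs : List R} (h : IsWeaklyRegular M rs) : IsWeaklyRegular (F →ₗ[R] M) rs :=
  (((Module.finBasis R F).constr R (M' := M)).isWeaklyRegular_congr rs).1 (isWeaklyRegular_pi h)

lemma length_modIdeal_free (I : Ideal R) (F : Type*) [AddCommGroup F] [Module R F]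
    [Module.Free R F] [Module.Finite R F] :
    Module.length R (ModIdeal I F) = Module.finrank R F * Module.length R (ModIdeal I R) := by
  rw [(modIdealEquiv I (Module.finBasis R F).equivFun).length_eq, length_modIdeal_pi,
    Fintype.card_fin]

lemma length_modIdeal_linearMap (I : Ideal R) (F : Type*) [AddCommGroup F] [Module R F]
    [Module.Free R F] [Module.Finite R F] (M : Type*) [AddCommGroup M] [Module R M] :
    Module.length R (ModIdeal I (F →ₗ[R] M)) =
      Module.finrank R F * Module.length R (ModIdeal I M) := by
  rw [(modIdealEquiv I ((Module.finBasis R F).constr R (M' := M)).symm).length_eq,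
    length_modIdeal_pi, Fintype.card_fin]

/-- By Nakayama's lemma, a map with image in `𝔪 N'` is not surjective modulo `I`. -/
lemma not_surjective_modIdealMap {I : Ideal R} (hI : I ≤ maximalIdeal R) {N N' : Type*}
    [AddCommGroup N] [Module R N] [AddCommGroup N'] [Module R N'] [Module.Finite R N']
    [Nontrivial N'] {f : N →ₗ[R] N'} (hf : LinearMap.range f ≤ maximalIdeal R • ⊤) :
    ¬ Surjective (modIdealMap I f) := by
  intro h
  refine (Submodule.top_ne_ideal_smul_of_le_jacobson_annihilator (R := R) (M := N')
    (maximalIdeal_le_jacobson _)).symm ?_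
  rw [eq_top_iff]
  intro y _
  obtain ⟨x, hx⟩ := h (Submodule.mkQ _ y)
  obtain ⟨x, rfl⟩ := Submodule.mkQ_surjective _ x
  have h' : f x - y ∈ I • (⊤ : Submodule R N') := (Submodule.Quotient.eq _).1 hx
  have := sub_mem (hf ⟨x, rfl⟩) (Submodule.smul_mono_left hI h')
  simpa using this

variable [IsNoetherianRing R]

/-- Let `F → M` be a minimal free resolution such that `0 → R → Hom(F₀, M) → Hom(F₁, M) → ⋯` is
exact, and let `rs` be regular on `R` and on `M` with `R / (rs)` Artinian. Then no free module of
rank one occurs in a positive degree of `F`. -/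
theorem finrank_ne_one_of_isArtinian_quotient {F : ℕ → Type*} {M : Type*}
    [∀ i, AddCommGroup (F i)] [∀ i, Module R (F i)] [∀ i, Module.Free R (F i)]
    [∀ i, Module.Finite R (F i)] [AddCommGroup M] [Module R M] [Module.Finite R M]
    (d : ∀ i, F (i + 1) →ₗ[R] F i) (ε : F 0 →ₗ[R] M) (hε : Surjective ε)
    (h₀ : Exact (d 0) ε) (hd : ∀ i, Exact (d (i + 1)) (d i))
    (hmin : ∀ i, LinearMap.range (d i) ≤ maximalIdeal R • ⊤)
    (hη : Injective (LinearMap.toSpanSingleton R (F 0 →ₗ[R] M) ε))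
    (hη₀ : Exact (LinearMap.toSpanSingleton R (F 0 →ₗ[R] M) ε) ((d 0).lcomp R M))
    (hηd : ∀ i, Exact ((d i).lcomp R M) ((d (i + 1)).lcomp R M))
    {rs : List R} (hrs : ∀ r ∈ rs, r ∈ maximalIdeal R) (hR : IsWeaklyRegular R rs)
    (hM : IsWeaklyRegular M rs) [IsArtinianRing (R ⧸ Ideal.ofList rs)] (n : ℕ) :
    Module.finrank R (F (n + 1)) ≠ 1 := by
  intro hn
  set I := Ideal.ofList rs with hI'
  have hI : I ≤ maximalIdeal R := Ideal.span_le.2 hrs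
  obtain ⟨hK₀, hK⟩ := exact_modIdealMap_descending rs d ε (fun i => isWeaklyRegular_of_free hR) hM
    hε h₀ hd
  obtain ⟨hG, hG₀, hG₁⟩ := exact_modIdealMap_ascending rs (K := fun i => F i →ₗ[R] M)
    (fun i => (d i).lcomp R M)
    (LinearMap.toSpanSingleton R (F 0 →ₗ[R] M) ε)
    (fun i => isWeaklyRegular_linearMap_of_free hM) hη hη₀ hηd
  have hMlt : Module.length R (ModIdeal I M) ≠ ⊤ := by
    obtain ⟨_, _⟩ := modIdeal_finite_length (I := I) M
    exact Module.length_ne_top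
  have hRlt : Module.length R (ModIdeal I R) ≠ ⊤ := by
    obtain ⟨_, _⟩ := modIdeal_finite_length (I := I) R
    exact Module.length_ne_top
  have hF (i : ℕ) : IsArtinian R (ModIdeal I (F i)) := (modIdeal_finite_length (I := I) _).1
  have hH (i : ℕ) : IsArtinian R (ModIdeal I (F i →ₗ[R] M)) :=
    (modIdeal_finite_length (I := I) _).1
  -- Index `0` holds the augmentations, so that index `i + 1` holds the image of `d i`.
  let z' : ℕ → ℕ∞ := fun i => match i with
    | 0 => Module.length R (ModIdeal I M)
    | i + 1 => Module.length R (LinearMap.range (modIdealMap I (d i)))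
  let w' : ℕ → ℕ∞ := fun i => match i with
    | 0 => Module.length R (ModIdeal I R)
    | i + 1 => Module.length R (LinearMap.range (modIdealMap I ((d i).lcomp R M)))
  have hz' (i : ℕ) : z' i ≠ ⊤ := by
    cases i with
    | zero => exact hMlt
    | succ i => exact Module.length_ne_top
  have hw' (i : ℕ) : w' i ≠ ⊤ := by
    cases i with
    | zero => exact hRlt
    | succ i => exact Module.length_ne_top
  have hz (i : ℕ) :
      z' i + z' (i + 1) = Module.finrank R (F i) * Module.length R (ModIdeal I R) := by
    rw [← length_modIdeal_free, add_comm]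
    cases i with
    | zero =>
      rw [length_eq_range_add_range hK₀,
        LinearMap.range_eq_top.2 (modIdealMap_surjective I hε), Module.length_top]
    | succ i => exact (length_eq_range_add_range (hK i)).symm
  have hw (i : ℕ) :
      w' i + w' (i + 1) = Module.finrank R (F i) * Module.length R (ModIdeal I M) := by
    rw [← length_modIdeal_linearMap]
    cases i with
    | zero =>
      rw [length_eq_range_add_range hG₀,
        ← (LinearEquiv.ofInjective _ hG).length_eq]
    | succ i => exact (length_eq_range_add_range (hG₁ i)).symm
  have hFn : Nontrivial (F (n + 1)) := Module.nontrivial_of_finrank_pos (R := R) (by omega)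
  let e : F (n + 1) ≃ₗ[R] R := by
    refine (Module.finBasis R (F (n + 1))).equivFun ≪≫ₗ ?_
    rw [hn]
    exact LinearEquiv.funUnique (Fin 1) R R
  refine false_of_length_relations (z := fun i => (z' i).toNat) (w := fun i => (w' i).toNat)
    (b := fun i => Module.finrank R (F i)) (m := (Module.length R (ModIdeal I M)).toNat)
    (r := (Module.length R (ModIdeal I R)).toNat) (n := n + 1) rfl rfl (fun i => ?_) (fun i => ?_)
    hn ?_ ?_
  · rw [← ENat.toNat_add (hz' i) (hz' (i + 1)), hz i, ENat.toNat_mul, ENat.toNat_natCast]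
  · rw [← ENat.toNat_add (hw' i) (hw' (i + 1)), hw i, ENat.toNat_mul, ENat.toNat_natCast]
  · -- If `d n` vanishes modulo `I`, then `d (n + 1)` is surjective modulo `I`, against minimality.
    rw [Nat.pos_iff_ne_zero]
    intro h
    have h : Module.length R (LinearMap.range (modIdealMap I (d n))) = 0 := by
      exact (ENat.toNat_eq_zero.1 h).resolve_right (hz' (n + 1))
    rw [Module.length_eq_zero_iff, Submodule.subsingleton_iff_eq_bot,
      LinearMap.range_eq_bot] at h
    refine not_surjective_modIdealMap hI (hmin (n + 1)) fun y => ?_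
    exact (hK n y).1 (by rw [h]; rfl)
  · -- Identifying `Hom(F (n + 1), M)` with `M`, the image of the dual of `d n` lies in `𝔪 M`.
    have hMn : Nontrivial M := by
      by_contra hMs
      rw [not_nontrivial_iff_subsingleton] at hMs
      exact one_ne_zero (hη (Subsingleton.elim (LinearMap.toSpanSingleton R _ ε 1)
        (LinearMap.toSpanSingleton R _ ε 0)))
    let e' : (F (n + 1) →ₗ[R] M) ≃ₗ[R] M :=
      e.congrLeft M R ≪≫ₗ LinearMap.ringLmapEquivSelf R R M
    have hlen : Module.length R (ModIdeal I M) = Module.length R (ModIdeal I (F (n + 1) →ₗ[R] M)) :=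
      (modIdealEquiv I e').length_eq.symm
    have hlt : Module.length R (LinearMap.range (modIdealMap I ((d n).lcomp R M))) <
        Module.length R (ModIdeal I M) := by
      rw [hlen]
      refine Submodule.length_lt fun htop => ?_
      rw [LinearMap.range_eq_top] at htop
      refine not_surjective_modIdealMap (f := e'.toLinearMap ∘ₗ (d n).lcomp R M) hI ?_ ?_
      · rintro _ ⟨φ, rfl⟩
        change φ (d n (e.symm 1)) ∈ _
        have := Submodule.mem_map_of_mem (f := φ) (hmin n ⟨e.symm 1, rfl⟩)
        rw [Submodule.map_smul''] at this
        exact (smul_mono_right (maximalIdeal R) le_top :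
          maximalIdeal R • Submodule.map φ ⊤ ≤ _) this
      · intro y
        obtain ⟨x, hx⟩ := htop ((modIdealEquiv I e').symm y)
        refine ⟨x, ?_⟩
        rw [← (modIdealEquiv I e').apply_symm_apply y, ← hx]
        obtain ⟨x, rfl⟩ := Submodule.mkQ_surjective _ x
        rfl
    change (Module.length R (LinearMap.range (modIdealMap I ((d n).lcomp R M)))).toNat < _
    rwa [← ENat.natCast_lt_natCast, ENat.natCast_toNat hMlt, ENat.natCast_toNat (hw' (n + 1))]

end ArtinianReduction

/-! ### Ranks in a minimal resolution: modules with a rank -/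

section GenericRank

open Function IsLocalRing

/-- If the image of a linear map out of a finite free module is projective of constant rank,
then so is the image of the preceding map in an exact sequence. -/
lemma range_projective_of_exact {Q : Type*} [CommRing Q] [Nontrivial Q] {A B C : Type*}
    [AddCommGroup A] [Module Q A] [AddCommGroup B] [Module Q B] [AddCommGroup C] [Module Q C]
    [Module.Free Q B] [Module.Finite Q B] {f : A →ₗ[Q] B} {g : B →ₗ[Q] C} (h : Exact f g) {σ : ℕ}
    (hg : Module.Projective Q (LinearMap.range g))
    (hσ : ∀ p, Module.rankAtStalk (R := Q) (LinearMap.range g) p = σ) :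
    Module.Projective Q (LinearMap.range f) ∧ Module.Finite Q (LinearMap.range f) ∧
      ∃ ρ, ρ + σ = Module.finrank Q B ∧
        ∀ p, Module.rankAtStalk (R := Q) (LinearMap.range f) p = ρ := by
  obtain ⟨l, hl⟩ := Module.projective_lifting_property g.rangeRestrict LinearMap.id
    g.surjective_rangeRestrict
  have h' : Exact (LinearMap.range f).subtype g.rangeRestrict := by
    intro x
    rw [← LinearMap.mem_ker, LinearMap.ker_rangeRestrict, LinearMap.mem_ker, h x]
    simp
  let e : B ≃ₗ[Q] LinearMap.range f × LinearMap.range g :=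
    (h'.splitSurjectiveEquiv (Submodule.subtype_injective _) ⟨l, hl⟩).1
  have hP : Module.Projective Q (LinearMap.range f) :=
    Module.Projective.of_split
      (e.symm.toLinearMap ∘ₗ LinearMap.inl Q (LinearMap.range f) (LinearMap.range g))
      (LinearMap.fst Q (LinearMap.range f) (LinearMap.range g) ∘ₗ e.toLinearMap) (by ext x; simp)
  have hF : Module.Finite Q (LinearMap.range f) :=
    Module.Finite.of_surjective
      (LinearMap.fst Q (LinearMap.range f) (LinearMap.range g) ∘ₗ e.toLinearMap)
      (Prod.fst_surjective.comp e.surjective)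
  have hrank (p : PrimeSpectrum Q) : Module.rankAtStalk (R := Q) (LinearMap.range f) p + σ =
      Module.finrank Q B := by
    have h₁ := congrFun (Module.rankAtStalk_eq_of_equiv e) p
    rw [Module.rankAtStalk_prod, Module.rankAtStalk_eq_finrank_of_free] at h₁
    simpa [hσ] using h₁.symm
  obtain ⟨p₀⟩ : Nonempty (PrimeSpectrum Q) := inferInstance
  refine ⟨hP, hF, _, hrank p₀, fun p => ?_⟩
  have := hrank p
  have := hrank p₀
  omega

variable {R : Type u} [CommRing R]

open TensorProduct in
lemma eq_zero_of_baseChange_fractionRing_eq_zero {F G : Type*} [AddCommGroup F] [Module R F]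
    [AddCommGroup G] [Module R G] [Module.Flat R G] {f : F →ₗ[R] G}
    (h : f.baseChange (FractionRing R) = 0) : f = 0 := by
  ext x
  have h₁ := Module.Flat.rTensor_preserves_injective_linearMap (M := G)
    (Algebra.linearMap R (FractionRing R)) (IsFractionRing.injective R (FractionRing R))
  have h₂ : (1 : FractionRing R) ⊗ₜ[R] f x = 0 := LinearMap.congr_fun h (1 ⊗ₜ[R] x)
  have h₃ : (1 : R) ⊗ₜ[R] f x = 0 := h₁ (by simpa using h₂)
  simpa using congrArg (TensorProduct.lid R G) h₃

lemma exact_baseChange (Q : Type*) [CommRing Q] [Algebra R Q] [Module.Flat R Q] {A B C : Type*}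
    [AddCommGroup A] [Module R A] [AddCommGroup B] [Module R B] [AddCommGroup C] [Module R C]
    {f : A →ₗ[R] B} {g : B →ₗ[R] C} (h : Exact f g) :
    Exact (f.baseChange Q) (g.baseChange Q) :=
  Module.Flat.lTensor_exact Q h

variable [IsLocalRing R]

lemma maximalIdeal_smul_top_ne_top (N : Type*) [AddCommGroup N] [Module R N] [Module.Finite R N]
    [Nontrivial N] : maximalIdeal R • (⊤ : Submodule R N) ≠ ⊤ :=
  (Submodule.top_ne_ideal_smul_of_le_jacobson_annihilator (maximalIdeal_le_jacobson _)).symm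

/-- Let `F → M` be a minimal free resolution of a nonzero module with a rank such that
`Hom(F, M)` is exact in positive degrees. Then no free module of rank one occurs in a positive
degree of `F`. -/
theorem finrank_ne_one_of_hasRank {F : ℕ → Type*} {M : Type u}
    [∀ i, AddCommGroup (F i)] [∀ i, Module R (F i)] [∀ i, Module.Free R (F i)]
    [∀ i, Module.Finite R (F i)] [AddCommGroup M] [Module R M] [Module.Finite R M] [Nontrivial M]
    (d : ∀ i, F (i + 1) →ₗ[R] F i) (ε : F 0 →ₗ[R] M) (hε : Surjective ε)
    (h₀ : Exact (d 0) ε) (hd : ∀ i, Exact (d (i + 1)) (d i))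
    (hmin : ∀ i, LinearMap.range (d i) ≤ maximalIdeal R • ⊤)
    (hηd : ∀ i, Exact ((d i).lcomp R M) ((d (i + 1)).lcomp R M))
    (hM : HasRank R M) (n : ℕ) :
    Module.finrank R (F (n + 1)) ≠ 1 := by
  intro hn
  obtain ⟨r, ⟨e⟩⟩ := hM
  let Q := FractionRing R
  have hfree : Module.Free Q (TensorProduct R Q M) := Module.Free.of_equiv e.symm
  have hεQ : LinearMap.range (ε.baseChange Q) = ⊤ :=
    LinearMap.range_eq_top.2 (LinearMap.lTensor_surjective Q hε)
  -- The generic ranks of the syzygies, by induction from the rank of `M`.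
  have hrange (i : ℕ) : Module.Projective Q (LinearMap.range ((d i).baseChange Q)) ∧
      Module.Finite Q (LinearMap.range ((d i).baseChange Q)) ∧
      ∃ ρ, ∀ p, Module.rankAtStalk (R := Q) (LinearMap.range ((d i).baseChange Q)) p = ρ := by
    induction i with
    | zero =>
      let e' : LinearMap.range (ε.baseChange Q) ≃ₗ[Q] (Fin r → Q) :=
        LinearEquiv.ofTop _ hεQ ≪≫ₗ e
      obtain ⟨h₁, h₂, ρ, -, h₃⟩ := range_projective_of_exact
        (exact_baseChange Q h₀)
        (σ := r) (Module.Projective.of_equiv e'.symm)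
        (fun p => by
          rw [Module.rankAtStalk_eq_of_equiv e', Module.rankAtStalk_eq_finrank_of_free]
          simp)
      exact ⟨h₁, h₂, ρ, h₃⟩
    | succ i ih =>
      obtain ⟨h₁, -, ρ, h₂⟩ := ih
      obtain ⟨h₁, h₂, ρ, -, h₃⟩ := range_projective_of_exact
        (exact_baseChange Q (hd i)) h₁ h₂
      exact ⟨h₁, h₂, ρ, h₃⟩
  have hzero (i : ℕ) (h : ∀ p,
      Module.rankAtStalk (R := Q) (LinearMap.range ((d i).baseChange Q)) p = 0) : d i = 0 := by
    obtain ⟨_, _, -⟩ := hrange i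
    have := (Module.rankAtStalk_eq_zero_iff_subsingleton (R := Q)).1 (funext h)
    rw [Submodule.subsingleton_iff_eq_bot, LinearMap.range_eq_bot] at this
    exact eq_zero_of_baseChange_fractionRing_eq_zero this
  have hFn : Nontrivial (F (n + 1)) := Module.nontrivial_of_finrank_pos (R := R) (by omega)
  obtain ⟨h₁, -, σ, h₂⟩ := hrange n
  obtain ⟨-, -, ρ, h₃, h₄⟩ := range_projective_of_exact
    (exact_baseChange Q (hd n)) h₁ h₂
  have hsum : ρ + σ = 1 := by
    rw [h₃]
    exact (Module.finrank_baseChange (R := Q) (S := R) (M' := F (n + 1))).trans hn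
  obtain hρ | hσ : ρ = 0 ∨ σ = 0 := by omega
  · -- Here `d (n + 1) = 0`, so all maps `F (n + 1) → M` factor through `d n`, and `M = 𝔪 M`.
    have hdn := hzero (n + 1) (by simpa [hρ] using h₄)
    let e₁ : F (n + 1) ≃ₗ[R] R := by
      refine (Module.finBasis R (F (n + 1))).equivFun ≪≫ₗ ?_
      rw [hn]
      exact LinearEquiv.funUnique (Fin 1) R R
    refine maximalIdeal_smul_top_ne_top (R := R) M (eq_top_iff.2 fun y _ => ?_)
    obtain ⟨ψ, hψ⟩ := (hηd n (LinearMap.toSpanSingleton R M y ∘ₗ e₁.toLinearMap)).1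
      (by rw [hdn]; ext; simp)
    have h₅ : ψ (d n (e₁.symm 1)) = y := by
      simpa using LinearMap.congr_fun hψ (e₁.symm 1)
    rw [← h₅]
    have := Submodule.mem_map_of_mem (f := ψ) (hmin n ⟨e₁.symm 1, rfl⟩)
    rw [Submodule.map_smul''] at this
    exact (smul_mono_right (maximalIdeal R) le_top :
      maximalIdeal R • Submodule.map ψ ⊤ ≤ _) this
  · -- Here `d n = 0`, so `d (n + 1)` is surjective, against minimality.
    have hdn := hzero n (by simpa [hσ] using h₂)
    refine maximalIdeal_smul_top_ne_top (R := R) (F (n + 1))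
      (eq_top_iff.2 fun y _ => hmin (n + 1) ?_)
    exact (hd n y).1 (by rw [hdn]; rfl)

end GenericRank

/-! ### Minimal free resolutions -/

section MinimalResolution

open IsLocalRing Function

lemma moduleCat_exact_mk {R : Type*} [Ring R] {X Y Z : ModuleCat R} {f : X ⟶ Y} {g : Y ⟶ Z}
    (zero : f ≫ g = 0) (h : Exact f.hom g.hom) : (ShortComplex.mk f g zero).Exact :=
  (ShortComplex.ShortExact.moduleCat_exact_iff_function_exact _).2 h

/-- A projective resolution built from an exact sequence `⋯ → X₂ → X₁ → X₀ → M → 0`. -/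
def projectiveResolutionOfExact {A : Type*} [Category* A] [Abelian A] {M : A}
    (K : ChainComplex A ℕ) [hK : ∀ n, Projective (K.X n)] (ε : K.X 0 ⟶ M) [Epi ε]
    (zero : K.d 1 0 ≫ ε = 0) (h₀ : (ShortComplex.mk _ _ zero).Exact)
    (h : ∀ n, (ShortComplex.mk _ _ (K.d_comp_d (n + 2) (n + 1) n)).Exact) :
    ProjectiveResolution M where
  complex := K
  π := (ChainComplex.toSingle₀Equiv _ _).symm ⟨ε, zero⟩
  quasiIso := ⟨fun n => by
    cases n
    · rw [ChainComplex.quasiIsoAt₀_iff, ShortComplex.quasiIso_iff_of_zeros']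
      · refine (ShortComplex.exact_and_epi_g_iff_of_iso ?_).2 ⟨h₀, inferInstance⟩
        exact ShortComplex.isoMk (Iso.refl _) (Iso.refl _) (Iso.refl _)
          ((Category.id_comp _).trans (Category.comp_id _).symm)
          ((Category.id_comp ε).trans
            ((ChainComplex.toSingle₀Equiv_symm_apply_f_zero ε zero).symm.trans
              (Category.comp_id _).symm))
      · exact K.shape _ _ (by simp)
      all_goals rfl
    · rw [quasiIsoAt_iff_exactAt']
      · rw [HomologicalComplex.exactAt_iff' _ _ _ _ (by simp; rfl) (by simp; rfl)]
        exact h _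
      · apply ChainComplex.exactAt_succ_single_obj⟩

variable {R : Type u} [CommRing R] [IsLocalRing R]

lemma mem_maximalIdeal_smul_top_pi {ι : Type*} [Fintype ι] [DecidableEq ι]
    (v : ι → R) (h : ∀ i, v i ∈ maximalIdeal R) :
    v ∈ maximalIdeal R • (⊤ : Submodule R (ι → R)) := by
  rw [← (Pi.basisFun R ι).sum_repr v]
  exact Submodule.sum_mem _ fun i _ => Submodule.smul_mem_smul (by simpa using h i) trivial

open TensorProduct in
/-- A finitely generated module over a local ring has a minimal free cover. -/
theorem exists_minimal_cover (N : Type u) [AddCommGroup N] [Module R N] [Module.Finite R N] :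
    ∃ (b : ℕ) (p : (Fin b → R) →ₗ[R] N), Surjective p ∧
      LinearMap.ker p ≤ maximalIdeal R • ⊤ := by
  let e := Module.finBasis (ResidueField R) (ResidueField R ⊗[R] N)
  have hs : ∀ i, ∃ x : N, (1 : ResidueField R) ⊗ₜ[R] x = e i := fun i =>
    TensorProduct.mk_surjective R N (ResidueField R) residue_surjective (e i)
  choose x hx using hs
  refine ⟨_, Fintype.linearCombination R x, ?_, fun v hv => ?_⟩
  · rw [← LinearMap.range_eq_top, Fintype.range_linearCombination]
    exact span_eq_top_of_tmul_eq_basis x e hx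
  · refine mem_maximalIdeal_smul_top_pi v fun i => ?_
    rw [LinearMap.mem_ker, Fintype.linearCombination_apply] at hv
    have h₁ : ∑ i, residue R (v i) • e i = 0 := by
      rw [← TensorProduct.tmul_zero (R := R) N (1 : ResidueField R), ← hv, TensorProduct.tmul_sum]
      refine Finset.sum_congr rfl fun i _ => ?_
      rw [← hx, TensorProduct.tmul_smul]
      rfl
    exact (residue_eq_zero_iff _).1 (Fintype.linearIndependent_iff.1 e.linearIndependent _ h₁ i)

/-- Finitely generated modules, bundled so that syzygies can be iterated by recursion. -/
structure FiniteModule (R : Type u) [CommRing R] where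
  /-- the underlying module -/
  obj : ModuleCat.{u} R
  finite : Module.Finite R obj

attribute [instance] FiniteModule.finite

/-- The rank of a chosen minimal free cover. -/
def coverRank (N : FiniteModule R) : ℕ := (exists_minimal_cover (R := R) N.obj).choose

/-- A minimal free cover: a surjection from a free module with kernel in `𝔪` times that module. -/
def cover (N : FiniteModule R) : (Fin (coverRank N) → R) →ₗ[R] N.obj :=
  (exists_minimal_cover (R := R) N.obj).choose_spec.choose

lemma cover_surjective (N : FiniteModule R) : Surjective (cover N) :=
  (exists_minimal_cover (R := R) N.obj).choose_spec.choose_spec.1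

lemma ker_cover_le (N : FiniteModule R) : LinearMap.ker (cover N) ≤ maximalIdeal R • ⊤ :=
  (exists_minimal_cover (R := R) N.obj).choose_spec.choose_spec.2

variable [IsNoetherianRing R]

/-- The first syzygy with respect to the minimal free cover. -/
def firstSyzygy (N : FiniteModule R) : FiniteModule R :=
  ⟨ModuleCat.of R (LinearMap.ker (cover N)), inferInstance⟩

/-- The inclusion of the first syzygy in the minimal free cover. -/
def firstSyzygyInclusion (N : FiniteModule R) :
    (firstSyzygy N).obj →ₗ[R] (Fin (coverRank N) → R) :=
  (LinearMap.ker (cover N)).subtype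

/-- The differential of the minimal free resolution: the minimal free cover of the first syzygy. -/
def coverD (N : FiniteModule R) :
    (Fin (coverRank (firstSyzygy N)) → R) →ₗ[R] (Fin (coverRank N) → R) :=
  firstSyzygyInclusion N ∘ₗ cover (firstSyzygy N)

lemma range_coverD (N : FiniteModule R) :
    LinearMap.range (coverD N) = LinearMap.ker (cover N) := by
  rw [coverD, LinearMap.range_comp, LinearMap.range_eq_top.2 (cover_surjective _),
    Submodule.map_top]
  exact Submodule.range_subtype _

lemma ker_coverD (N : FiniteModule R) :
    LinearMap.ker (coverD N) = LinearMap.ker (cover (firstSyzygy N)) :=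
  LinearMap.ker_comp_of_ker_eq_bot _ (Submodule.ker_subtype (LinearMap.ker (cover N)))

lemma exact_coverD (N : FiniteModule R) : Exact (coverD (firstSyzygy N)) (coverD N) := by
  rw [LinearMap.exact_iff, ker_coverD, range_coverD]

/-- The iterated syzygies with respect to minimal free covers. -/
def syzygy (N : FiniteModule R) : ℕ → FiniteModule R
  | 0 => N
  | i + 1 => firstSyzygy (syzygy N i)

/-- The minimal free resolution, as a chain complex. -/
def minimalComplex (N : FiniteModule R) : ChainComplex (ModuleCat.{u} R) ℕ :=
  ChainComplex.of (fun i => ModuleCat.of R (Fin (coverRank (syzygy N i)) → R))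
    (fun i => ModuleCat.ofHom (coverD (syzygy N i))) (fun i => by
      ext : 1
      exact (exact_coverD (syzygy N i)).linearMap_comp_eq_zero)

lemma minimalComplex_d (N : FiniteModule R) (i : ℕ) :
    (minimalComplex N).d (i + 1) i = ModuleCat.ofHom (coverD (syzygy N i)) :=
  ChainComplex.of_d (fun i => ModuleCat.of R (Fin (coverRank (syzygy N i)) → R))
    (fun i => ModuleCat.ofHom (coverD (syzygy N i))) i

/-- A finitely generated module over a Noetherian local ring has a minimal free resolution. -/
theorem exists_minimal_projectiveResolution (M : ModuleCat.{u} R) [Module.Finite R M] :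
    ∃ P : ProjectiveResolution M, (∀ i, Module.Free R (P.complex.X i)) ∧
      (∀ i, Module.Finite R (P.complex.X i)) ∧
      ∀ i, LinearMap.range (P.complex.d (i + 1) i).hom ≤ maximalIdeal R • ⊤ := by
  let N : FiniteModule R := ⟨M, inferInstance⟩
  let K := minimalComplex N
  have hKd (i : ℕ) : K.d (i + 1) i = ModuleCat.ofHom (coverD (syzygy N i)) := minimalComplex_d N i
  have hfree (i : ℕ) : Module.Free R (K.X i) :=
    inferInstanceAs (Module.Free R (Fin (coverRank (syzygy N i)) → R))
  have hfin (i : ℕ) : Module.Finite R (K.X i) :=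
    inferInstanceAs (Module.Finite R (Fin (coverRank (syzygy N i)) → R))
  have hproj (i : ℕ) : Projective (K.X i) := ModuleCat.projective_of_free
    (Module.Free.chooseBasis R (K.X i))
  let ε : K.X 0 ⟶ M := ModuleCat.ofHom (cover N)
  have hε : Epi ε := (ModuleCat.epi_iff_surjective _).2 (cover_surjective N)
  have hε₀ : Exact (coverD N) (cover N) := by
    rw [LinearMap.exact_iff, range_coverD]
  have zero : K.d 1 0 ≫ ε = 0 := by
    rw [hKd]
    ext : 1
    exact hε₀.linearMap_comp_eq_zero
  refine ⟨projectiveResolutionOfExact K ε zero ?_ ?_, hfree, hfin, fun i => ?_⟩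
  · refine moduleCat_exact_mk _ ?_
    rw [hKd]
    exact hε₀
  · intro n
    refine moduleCat_exact_mk _ ?_
    rw [hKd, hKd]
    exact exact_coverD (syzygy N n)
  · change LinearMap.range (K.d (i + 1) i).hom ≤ _
    rw [hKd]
    exact (range_coverD _).le.trans (ker_cover_le _)

end MinimalResolution

/-! ### Betti numbers via minimal resolutions -/

section KProjective

open DerivedCategory CochainComplex

variable {A : Type*} [Category* A] [Abelian A] [HasDerivedCategory.{w} A]

/-- Morphisms out of a K-projective complex in the derived category come from chain maps. -/
lemma exists_Q_map_eq {K L : CochainComplex A ℤ} [K.IsKProjective] (f : Q.obj K ⟶ Q.obj L) :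
    ∃ g : K ⟶ L, Q.map g = f := by
  obtain ⟨g, hg⟩ := (IsKProjective.Qh_map_bijective K
    ((HomotopyCategory.quotient _ _).obj L)).surjective
      ((quotientCompQhIso A).hom.app K ≫ f ≫ (quotientCompQhIso A).inv.app L)
  obtain ⟨g, rfl⟩ := (HomotopyCategory.quotient _ _).map_surjective g
  refine ⟨g, ?_⟩
  rw [← cancel_epi ((quotientCompQhIso A).hom.app K), ← quotientCompQhIso_hom_naturality, hg]
  simp

lemma nonempty_homotopy_of_Q_map_eq {K L : CochainComplex A ℤ} [K.IsKProjective] {f g : K ⟶ L}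
    (h : Q.map f = Q.map g) : Nonempty (Homotopy f g) := by
  refine ⟨HomotopyCategory.homotopyOfEq _ _ ((IsKProjective.Qh_map_bijective K
    ((HomotopyCategory.quotient _ _).obj L)).injective ?_)⟩
  rw [← cancel_mono ((quotientCompQhIso A).hom.app L), quotientCompQhIso_hom_naturality,
    quotientCompQhIso_hom_naturality, h]

lemma nonempty_homotopyEquiv_of_iso {K L : CochainComplex A ℤ} [K.IsKProjective]
    [L.IsKProjective] (e : Q.obj K ≅ Q.obj L) : Nonempty (HomotopyEquiv K L) := by
  obtain ⟨g, hg⟩ := exists_Q_map_eq e.hom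
  have : IsIso (Q.map g) := by rw [hg]; infer_instance
  rw [isIso_Q_map_iff_quasiIso, IsKProjective.quasiIso_iff] at this
  exact ⟨this.choose⟩

variable {R : Type u} [CommRing R]

lemma isKProjective_projRes (C : CochainComplex (ModuleCat.{u} R) ℤ)
    [IsHomologicallyBounded C] : (projRes C).P.IsKProjective := by
  obtain ⟨b, hb⟩ := (projRes C).exists_isStrictlyLE
  have := (projRes C).projective
  exact isKProjective_of_projective _ b

/-- The isomorphism in the derived category from the projective resolution of `C` to `C`. -/
def projResIso [HasDerivedCategory.{w} (ModuleCat.{u} R)]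
    (C : CochainComplex (ModuleCat.{u} R) ℤ) [IsHomologicallyBounded C] :
    Q.obj (projRes C).P ≅ Q.obj C :=
  have := (projRes C).quasiIso
  asIso (Q.map (projRes C).π)

/-- If `C` is isomorphic to a shift of a module `M` in the derived category, its projective
resolution is homotopy equivalent to the shift of any projective resolution of `M`. -/
lemma nonempty_homotopyEquiv_projRes [HasDerivedCategory.{w} (ModuleCat.{u} R)]
    (C : CochainComplex (ModuleCat.{u} R) ℤ)
    [IsHomologicallyBounded C] {M : ModuleCat.{u} R} (P : ProjectiveResolution M) {s : ℤ}
    (e : Q.obj C ≅ ((DerivedCategory.singleFunctor (ModuleCat.{u} R) 0).obj M)⟦s⟧) :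
    Nonempty (HomotopyEquiv (projRes C).P (P.cochainComplex⟦s⟧)) := by
  have := isKProjective_projRes C
  exact nonempty_homotopyEquiv_of_iso (projResIso C ≪≫ e ≪≫
    (CategoryTheory.shiftFunctor _ s).mapIso ((singleFunctorIsoCompQ _ 0).app M ≪≫
      (asIso (Q.map P.π')).symm) ≪≫ (Q.commShiftIso s).symm.app P.cochainComplex)

end KProjective

section Betti

open DerivedCategory CochainComplex IsLocalRing

variable {R : Type u} [CommRing R] [IsLocalRing R]

lemma map_units_smul_eq_zero {A B : Type*} [Category* A] [Preadditive A] [Category* B]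
    [Preadditive B] (F : A ⥤ B) [F.Additive] {X Y : A} {f : X ⟶ Y} (hf : F.map f = 0) (a : ℤˣ) :
    F.map (a • f) = 0 := by
  rw [Functor.map_units_smul, hf, smul_zero]

lemma extendScalars_map_eq_zero {X Y : ModuleCat.{u} R} {f : X ⟶ Y}
    (hf : LinearMap.range f.hom ≤ maximalIdeal R • ⊤) :
    (ModuleCat.extendScalars.{u, u, u} (residue R)).map f = 0 := by
  ext x
  change TensorProduct.mk R (ResidueField R) Y 1 (f.hom x) = 0
  have h : maximalIdeal R • (⊤ : Submodule R Y) ≤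
      LinearMap.ker (TensorProduct.mk R (ResidueField R) Y 1) := by
    refine Submodule.smul_le.2 fun r hr y _ => ?_
    rw [LinearMap.mem_ker, map_smul, TensorProduct.mk_apply, TensorProduct.smul_tmul']
    have : r • (1 : ResidueField R) = 0 := by
      rw [Algebra.smul_def, mul_one]
      exact (residue_eq_zero_iff r).2 hr
    rw [this, TensorProduct.zero_tmul]
  exact h (hf ⟨x, rfl⟩)

lemma finrank_extendScalars (X : ModuleCat.{u} R) [Module.Free R X] :
    Module.finrank (ResidueField R) ((ModuleCat.extendScalars.{u, u, u} (residue R)).obj X) =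
      Module.finrank R X :=
  Module.finrank_baseChange (R := ResidueField R) (S := R) (M' := X)

/-- Betti numbers can be read off from any complex which is homotopy equivalent to the projective
resolution and whose differential vanishes modulo the maximal ideal. -/
lemma betti_eq_finrank_of_homotopyEquiv (C : CochainComplex (ModuleCat.{u} R) ℤ)
    [IsHomologicallyBounded C] {L : CochainComplex (ModuleCat.{u} R) ℤ}
    (e : HomotopyEquiv (projRes C).P L)
    (hL : ∀ i j, (ModuleCat.extendScalars.{u, u, u} (residue R)).map (L.d i j) = 0) (n : ℤ) :
    betti C n = Module.finrank (ResidueField R)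
      ((ModuleCat.extendScalars.{u, u, u} (residue R)).obj (L.X (-n))) := by
  let F := ModuleCat.extendScalars.{u, u, u} (residue R)
  let K := (F.mapHomologicalComplex (ComplexShape.up ℤ)).obj L
  have h₁ : IsIso (K.iCycles (-n)) := K.isIso_iCycles (-n) (-n + 1) (by simp) (hL _ _)
  have h₂ : IsIso (K.homologyπ (-n)) := K.isIso_homologyπ (-n - 1) (-n) (by simp) (hL _ _)
  let e' : (residueTensor C).homology (-n) ≅ K.X (-n) :=
    (F.mapHomotopyEquiv e).toHomologyIso (-n) ≪≫ (asIso (K.homologyπ (-n))).symm ≪≫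
      asIso (K.iCycles (-n))
  exact e'.toLinearEquiv.finrank_eq

lemma extendScalars_map_cochainComplex_d {M : ModuleCat.{u} R}
    (P : ProjectiveResolution M)
    (hmin : ∀ i, LinearMap.range (P.complex.d (i + 1) i).hom ≤ maximalIdeal R • ⊤) (i j : ℤ) :
    (ModuleCat.extendScalars.{u, u, u} (residue R)).map (P.cochainComplex.d i j) = 0 := by
  by_cases hij : i + 1 = j
  · by_cases hj : j ≤ 0
    · obtain ⟨k, rfl⟩ := Int.exists_eq_neg_ofNat hj
      rw [P.cochainComplex_d i (-k) (k + 1) k (by push_cast; omega) rfl, Functor.map_comp,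
        Functor.map_comp, extendScalars_map_eq_zero (hmin k)]
      simp
    · rw [(P.cochainComplex.isZero_of_isStrictlyLE 0 j (by omega)).eq_of_tgt
        (P.cochainComplex.d i j) 0, Functor.map_zero]
  · rw [P.cochainComplex.shape _ _ hij, Functor.map_zero]

variable [HasDerivedCategory.{w} (ModuleCat.{u} R)]

variable (C : CochainComplex (ModuleCat.{u} R) ℤ) [IsHomologicallyBounded C]
  {M : ModuleCat.{u} R} (P : ProjectiveResolution M)
  (hmin : ∀ i, LinearMap.range (P.complex.d (i + 1) i).hom ≤ maximalIdeal R • ⊤) {s : ℤ}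
  (e : Q.obj C ≅ ((DerivedCategory.singleFunctor (ModuleCat.{u} R) 0).obj M)⟦s⟧)

include hmin e in
lemma betti_eq_finrank_shift (n : ℤ) :
    betti C n = Module.finrank (ResidueField R)
      ((ModuleCat.extendScalars.{u, u, u} (residue R)).obj (P.cochainComplex.X (-n + s))) := by
  obtain ⟨f⟩ := nonempty_homotopyEquiv_projRes C P e
  rw [betti_eq_finrank_of_homotopyEquiv C f]
  · rfl
  · intro i j
    exact map_units_smul_eq_zero _ (extendScalars_map_cochainComplex_d P hmin _ _) s.negOnePow

include hmin e in
/-- The Betti numbers of `Σ^s M` are the ranks in a minimal free resolution of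
`M`, shifted by `s`. -/
lemma betti_eq_finrank (hfree : ∀ i, Module.Free R (P.complex.X i)) (i : ℕ) :
    betti C (i + s) = Module.finrank R (P.complex.X i) := by
  rw [betti_eq_finrank_shift C P hmin e, ← finrank_extendScalars (P.complex.X i)]
  exact (((ModuleCat.extendScalars.{u, u, u} (residue R)).mapIso
    (P.cochainComplexXIso (-(i + s) + s) i (by ring))).toLinearEquiv).finrank_eq

include hmin e in
lemma betti_eq_zero (n : ℤ) (hn : n < s) : betti C n = 0 := by
  rw [betti_eq_finrank_shift C P hmin e]
  have h := P.cochainComplex.isZero_of_isStrictlyLE 0 (-n + s) (by omega)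
  have h' := (ModuleCat.extendScalars.{u, u, u} (residue R)).map_isZero h
  have := ModuleCat.subsingleton_of_isZero h'
  exact Module.finrank_zero_of_subsingleton

end Betti

/-! ### Self-extensions of a semidualizing complex -/

section QuasiIsoElements

open HomologicalComplex

variable {R : Type u} [CommRing R] {K L : CochainComplex (ModuleCat.{u} R) ℤ}

/-- A cycle of a complex of modules, as an element of the object of cycles. -/
lemma exists_iCycles_eq (K : CochainComplex (ModuleCat.{u} R) ℤ) {n m : ℤ} (hm : n + 1 = m)
    (x : K.X n) (hx : (K.d n m).hom x = 0) : ∃ y : K.cycles n, (K.iCycles n).hom y = x := by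
  have h : ModuleCat.ofHom (LinearMap.toSpanSingleton R (K.X n) x) ≫ K.d n m = 0 := by
    ext
    simp [hx]
  refine ⟨(K.liftCycles _ m (by simp [hm]) h).hom (1 : R), ?_⟩
  have := congrArg (fun f => f.hom (1 : R)) (K.liftCycles_i _ m (by simp [hm]) h)
  refine Eq.trans this ?_
  simp

lemma iCycles_injective (K : CochainComplex (ModuleCat.{u} R) ℤ) (n : ℤ) :
    Function.Injective (K.iCycles n).hom :=
  (ModuleCat.mono_iff_injective _).1 inferInstance

lemma homologyπ_surjective (K : CochainComplex (ModuleCat.{u} R) ℤ) (n : ℤ) :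
    Function.Surjective (K.homologyπ n).hom :=
  (ModuleCat.epi_iff_surjective _).1 inferInstance

lemma exists_d_eq_of_homologyπ_eq_zero {n m : ℤ} (hm : m + 1 = n) (y : K.cycles n)
    (hy : (K.homologyπ n).hom y = 0) : ∃ w : K.X m, (K.d m n).hom w = (K.iCycles n).hom y := by
  have h : (ShortComplex.mk _ _ (K.toCycles_comp_homologyπ m n)).Exact :=
    ShortComplex.exact_of_g_is_cokernel _ (K.homologyIsCokernel m n (by simp [← hm]))
  obtain ⟨w, hw⟩ := (ShortComplex.moduleCat_exact_iff _).1 h y hy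
  refine ⟨w, ?_⟩
  rw [← hw]
  exact congrArg (fun f => f.hom w) (K.toCycles_i m n).symm

lemma homologyπ_eq_zero_of_d_eq {n m : ℤ} (y : K.cycles n) (w : K.X m)
    (hw : (K.d m n).hom w = (K.iCycles n).hom y) : (K.homologyπ n).hom y = 0 := by
  have : (K.toCycles m n).hom w = y := iCycles_injective K n (by
    rw [← hw]
    exact congrArg (fun f => f.hom w) (K.toCycles_i m n))
  rw [← this]
  exact congrArg (fun f => f.hom w) (K.toCycles_comp_homologyπ m n)

variable (f : K ⟶ L)

lemma iCycles_cyclesMap_apply (n : ℤ) (y : K.cycles n) :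
    (L.iCycles n).hom ((cyclesMap f n).hom y) = (f.f n).hom ((K.iCycles n).hom y) :=
  congrArg (fun g => g.hom y) (cyclesMap_i f n)

lemma homologyπ_cyclesMap_apply (n : ℤ) (y : K.cycles n) :
    (L.homologyπ n).hom ((cyclesMap f n).hom y) =
      (homologyMap f n).hom ((K.homologyπ n).hom y) :=
  congrArg (fun g => g.hom y) (homologyπ_naturality f n).symm

variable [QuasiIso f]

lemma homologyMap_bijective (n : ℤ) : Function.Bijective (homologyMap f n).hom :=
  ConcreteCategory.bijective_of_isIso (homologyMap f n)

/-- Surjectivity of a quasi-isomorphism on homology, in terms of elements. -/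
lemma exists_eq_add_d_of_quasiIso {m n p : ℤ} (hm : m + 1 = n) (hp : n + 1 = p) (z : L.X n)
    (hz : (L.d n p).hom z = 0) : ∃ (k : K.X n) (w : L.X m), (K.d n p).hom k = 0 ∧
      z = (f.f n).hom k + (L.d m n).hom w := by
  obtain ⟨y, rfl⟩ := exists_iCycles_eq L hp z hz
  obtain ⟨c, hc⟩ := (homologyMap_bijective f n).surjective ((L.homologyπ n).hom y)
  obtain ⟨c, rfl⟩ := homologyπ_surjective K n c
  obtain ⟨w, hw⟩ := exists_d_eq_of_homologyπ_eq_zero (K := L) hm (y - (cyclesMap f n).hom c) (by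
    rw [map_sub, homologyπ_cyclesMap_apply, hc, sub_self])
  refine ⟨(K.iCycles n).hom c, w, congrArg (fun g => g.hom c) (K.iCycles_d n p), ?_⟩
  rw [hw, map_sub, iCycles_cyclesMap_apply]
  abel

/-- Injectivity of a quasi-isomorphism on homology, in terms of elements. -/
lemma exists_d_eq_of_quasiIso {m n p : ℤ} (hm : m + 1 = n) (hp : n + 1 = p) (k : K.X n)
    (hk : (K.d n p).hom k = 0) (w : L.X m) (hw : (f.f n).hom k = (L.d m n).hom w) :
    ∃ k' : K.X m, (K.d m n).hom k' = k := by
  obtain ⟨y, rfl⟩ := exists_iCycles_eq K hp k hk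
  refine exists_d_eq_of_homologyπ_eq_zero hm y ((homologyMap_bijective f n).injective ?_)
  rw [map_zero, ← homologyπ_cyclesMap_apply]
  exact homologyπ_eq_zero_of_d_eq _ w (by rw [iCycles_cyclesMap_apply, hw])

end QuasiIsoElements

section Homothety

open DerivedCategory CochainComplex HomComplex

variable {R : Type u} [CommRing R] {C : CochainComplex (ModuleCat.{u} R) ℤ}
  [IsHomologicallyBounded C]

lemma homothety_f_zero_apply (k : (ringComplex R).X 0) :
    ((homothety C).f 0).hom k =
      (((HomologicalComplex.singleObjXSelf (ComplexShape.up ℤ) 0 (ModuleCat.of R R)).hom).hom k :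
        R) • Cochain.ofHom (projRes C).π := by
  have := HomologicalComplex.mkHomFromSingle_f (K := rHom C C) (A := ModuleCat.of R R) (j := 0)
    (ModuleCat.ofHom (LinearMap.toSpanSingleton R (Cochain (projRes C).P C 0)
      (Cochain.ofHom (projRes C).π))) (fun k _ => by
      ext
      change δ 0 k ((1 : R) • Cochain.ofHom (projRes C).π) = 0
      rw [one_smul, δ_ofHom])
  exact congrArg (fun g => g.hom k) this

lemma cochain_ofHom_smul {K L : CochainComplex (ModuleCat.{u} R) ℤ} (f : K ⟶ L) (r : R) :
    Cochain.ofHom (r • f) = r • Cochain.ofHom f := by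
  ext
  simp

variable (hC : IsSemidualizing C)

include hC

lemma IsSemidualizing.exists_δ_eq {m n p : ℤ} (hm : m + 1 = n) (hp : n + 1 = p) (hn : n ≠ 0)
    (z : Cochain (projRes C).P C n) (hz : δ n p z = 0) :
    ∃ w : Cochain (projRes C).P C m, δ m n w = z := by
  have := hC.quasiIso_homothety
  obtain ⟨k, w, -, h⟩ := exists_eq_add_d_of_quasiIso (homothety C) hm hp z hz
  have hk : k = 0 := by
    have := ModuleCat.subsingleton_of_isZero (HomologicalComplex.isZero_single_obj_X
      (ComplexShape.up ℤ) 0 (ModuleCat.of R R) n hn)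
    exact Subsingleton.elim _ _
  refine ⟨w, ?_⟩
  rw [hk, map_zero, zero_add] at h
  exact h.symm

lemma IsSemidualizing.exists_eq_smul_add (z : Cochain (projRes C).P C 0) (hz : δ 0 1 z = 0) :
    ∃ (r : R) (w : Cochain (projRes C).P C (-1)),
      z = r • Cochain.ofHom (projRes C).π + δ (-1) 0 w := by
  have := hC.quasiIso_homothety
  obtain ⟨k, w, -, h⟩ := exists_eq_add_d_of_quasiIso (homothety C) (m := -1) (n := 0) (p := 1)
    (by simp) (by simp) z hz
  rw [homothety_f_zero_apply] at h
  exact ⟨_, w, h⟩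

lemma IsSemidualizing.eq_zero_of_smul_eq (r : R) (w : Cochain (projRes C).P C (-1))
    (h : r • Cochain.ofHom (projRes C).π = δ (-1) 0 w) : r = 0 := by
  have := hC.quasiIso_homothety
  let e := HomologicalComplex.singleObjXSelf (ComplexShape.up ℤ) 0 (ModuleCat.of R R)
  have he : e.hom.hom (e.inv.hom r) = r := congrArg (fun g => g.hom r) e.inv_hom_id
  obtain ⟨k', hk'⟩ := exists_d_eq_of_quasiIso (homothety C) (m := -1) (n := 0) (p := 1)
    (by simp) (by simp) (e.inv.hom r) (by rw [HomologicalComplex.single_obj_d]; rfl) w (by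
      rw [homothety_f_zero_apply]
      refine Eq.trans ?_ h
      exact congrArg (fun a : R => a • Cochain.ofHom (projRes C).π) he)
  rw [HomologicalComplex.single_obj_d] at hk'
  rw [← he, ← hk']
  exact map_zero _

variable [HasDerivedCategory.{w} (ModuleCat.{u} R)]

/-- All morphisms from a semidualizing complex to a nonzero shift of it vanish: in nonzero degrees
the cohomology of `RHom(C, C)` is that of `R`. -/
lemma IsSemidualizing.shiftedHom_eq_zero {j : ℤ} (hj : j ≠ 0) (f : Q.obj C ⟶ (Q.obj C)⟦j⟧) :
    f = 0 := by
  have := isKProjective_projRes C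
  obtain ⟨g, hg⟩ := exists_Q_map_eq ((projResIso C).hom ≫ f ≫ (Q.commShiftIso j).inv.app C)
  obtain ⟨w, hw⟩ := hC.exists_δ_eq (m := j - 1) (n := j) (p := j + 1) (by ring) rfl hj
    (Cocycle.equivHomShift g).1 (Cocycle.δ_eq_zero _ _)
  have h : CohomologyClass.toHom (CohomologyClass.mk (Cocycle.equivHomShift g)) = 0 := by
    rw [CohomologyClass.toHom_mk_eq_zero_iff]
    exact ⟨j - 1, by simp, w, hw⟩
  rw [CohomologyClass.toHom_mk, AddEquiv.symm_apply_apply,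
    HomotopyCategory.quotient_map_eq_zero_iff] at h
  have h' := DerivedCategory.Q_map_eq_of_homotopy _ h.some
  rw [hg, Functor.map_zero] at h'
  rw [← cancel_epi (projResIso C).hom, ← cancel_mono ((Q.commShiftIso j).inv.app C),
    Category.assoc, h', Limits.comp_zero, Limits.zero_comp]

lemma IsSemidualizing.exists_smul_id_eq (f : Q.obj C ⟶ Q.obj C) :
    ∃ r : R, f = r • 𝟙 (Q.obj C) := by
  have := isKProjective_projRes C
  obtain ⟨g, hg⟩ := exists_Q_map_eq ((projResIso C).hom ≫ f)
  obtain ⟨r, w, h⟩ := hC.exists_eq_smul_add (Cochain.ofHom g) (by simp)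
  refine ⟨r, ?_⟩
  have h' := DerivedCategory.Q_map_eq_of_homotopy _
    ((Cochain.equivHomotopy g (r • (projRes C).π)).symm ⟨w, by
      rw [h, add_comm, cochain_ofHom_smul]⟩)
  rw [hg, Functor.map_smul] at h'
  rw [← cancel_epi (projResIso C).hom, h', Linear.comp_smul, Category.comp_id]
  rfl

lemma IsSemidualizing.eq_zero_of_smul_id_eq_zero (r : R) (h : r • 𝟙 (Q.obj C) = 0) : r = 0 := by
  have := isKProjective_projRes C
  have h1 : Q.map (r • (projRes C).π) = Q.map 0 := by
    rw [Functor.map_smul, Functor.map_zero, ← Category.comp_id (Q.map (projRes C).π),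
      ← Linear.comp_smul, h, Limits.comp_zero]
  obtain ⟨h2⟩ := nonempty_homotopy_of_Q_map_eq h1
  obtain ⟨w, hw⟩ := Cochain.equivHomotopy _ _ h2
  refine hC.eq_zero_of_smul_eq r w ?_
  rw [Cochain.ofHom_zero, add_zero] at hw
  rw [← hw, cochain_ofHom_smul]

end Homothety

/-! ### Cohomology in the derived category -/

section HomologySequence

open DerivedCategory Limits Pretriangulated

variable {A : Type*} [Category* A] [Abelian A] [HasDerivedCategory.{w} A]

/-- The truncation morphism from an object with cohomology in degrees `≤ t` to its cohomology in
degree `t`. -/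
lemma exists_to_singleFunctor (X : DerivedCategory A) (t : ℤ) [X.IsLE t] :
    ∃ (M : A) (p : X ⟶ (singleFunctor A t).obj M), IsIso ((homologyFunctor A t).map p) := by
  obtain ⟨Z, B, hZ, hB, f, g, h, hT⟩ := TStructure.t.exists_triangle X (t - 1) t (by ring)
  have hZ' : Z.IsLE (t - 1) := ⟨hZ⟩
  have hB' : B.IsGE t := ⟨hB⟩
  have zero (j : ℤ) (hj : t - 1 < j) : IsZero ((homologyFunctor A j).obj Z) :=
    Z.isZero_of_isLE (t - 1) j hj
  have epi (j : ℤ) (hj : t ≤ j) : Epi ((homologyFunctor A j).map g) :=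
    (HomologySequence.epi_homologyMap_mor₂_iff _ hT j (j + 1) rfl).2
      ((zero (j + 1) (by lia)).eq_of_tgt _ _)
  have mono : Mono ((homologyFunctor A t).map g) :=
    (HomologySequence.mono_homologyMap_mor₂_iff _ hT t).2 ((zero t (by lia)).eq_of_src _ _)
  have hB'' : B.IsLE t := by
    rw [isLE_iff]
    intro j hj
    have := epi j hj.le
    exact IsZero.of_epi ((homologyFunctor A j).map g) (X.isZero_of_isLE t j hj)
  obtain ⟨M, ⟨e⟩⟩ := exists_iso_singleFunctor_obj_of_isGE_of_isLE B t
  have := epi t le_rfl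
  have : IsIso ((homologyFunctor A t).map g) := isIso_of_mono_of_epi _
  refine ⟨M, g ≫ e.hom, ?_⟩
  rw [Functor.map_comp]
  infer_instance

/-- The truncation morphism to an object with cohomology in degrees `≥ t` from its cohomology in
degree `t`. -/
lemma exists_from_singleFunctor (Y : DerivedCategory A) (t : ℤ) [Y.IsGE t] :
    ∃ (N : A) (i : (singleFunctor A t).obj N ⟶ Y), IsIso ((homologyFunctor A t).map i) := by
  obtain ⟨Z, B, hZ, hB, f, g, h, hT⟩ := TStructure.t.exists_triangle Y t (t + 1) rfl
  have hZ' : Z.IsLE t := ⟨hZ⟩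
  have hB' : B.IsGE (t + 1) := ⟨hB⟩
  have zero (j : ℤ) (hj : j < t + 1) : IsZero ((homologyFunctor A j).obj B) :=
    B.isZero_of_isGE (t + 1) j hj
  have mono (j : ℤ) (hj : j ≤ t) : Mono ((homologyFunctor A j).map f) :=
    (HomologySequence.mono_homologyMap_mor₁_iff _ hT (j - 1) j (by ring)).2
      ((zero (j - 1) (by lia)).eq_of_src _ _)
  have epi : Epi ((homologyFunctor A t).map f) :=
    (HomologySequence.epi_homologyMap_mor₁_iff _ hT t).2 ((zero t (by lia)).eq_of_tgt _ _)
  have hZ'' : Z.IsGE t := by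
    rw [isGE_iff]
    intro j hj
    have := mono j hj.le
    exact IsZero.of_mono ((homologyFunctor A j).map f) (Y.isZero_of_isGE t j hj)
  obtain ⟨N, ⟨e⟩⟩ := exists_iso_singleFunctor_obj_of_isGE_of_isLE Z t
  have := mono t le_rfl
  have : IsIso ((homologyFunctor A t).map f) := isIso_of_mono_of_epi _
  refine ⟨N, e.inv ≫ f, ?_⟩
  rw [Functor.map_comp]
  infer_instance

/-- A morphism from the top cohomology of `X` to the bottom cohomology of `Y`, in the same degree,
is induced by a morphism in the derived category. -/
lemma exists_homologyFunctor_map_eq {X Y : DerivedCategory A} (t : ℤ) [X.IsLE t] [Y.IsGE t]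
    (ψ : (homologyFunctor A t).obj X ⟶ (homologyFunctor A t).obj Y) :
    ∃ f : X ⟶ Y, (homologyFunctor A t).map f = ψ := by
  obtain ⟨M, p, hp⟩ := exists_to_singleFunctor X t
  obtain ⟨N, i, hi⟩ := exists_from_singleFunctor Y t
  let e := singleFunctorCompHomologyFunctorIso A t
  let φ : M ⟶ N := e.inv.app M ≫ inv ((homologyFunctor A t).map p) ≫ ψ ≫
    inv ((homologyFunctor A t).map i) ≫ e.hom.app N
  refine ⟨p ≫ (singleFunctor A t).map φ ≫ i, ?_⟩
  have h : (homologyFunctor A t).map ((singleFunctor A t).map φ) =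
      e.hom.app M ≫ φ ≫ e.inv.app N := (NatIso.naturality_2 e φ).symm
  rw [Functor.map_comp, Functor.map_comp, h]
  simp [φ]

/-- The cohomology of a shift. -/
def homologyShiftIso (X : DerivedCategory A) (n a b : ℤ) (h : n + a = b) :
    (homologyFunctor A a).obj (X⟦n⟧) ≅ (homologyFunctor A b).obj X :=
  ((homologyFunctor A 0).shiftIso n a b h).app X

end HomologySequence

section Linear

open DerivedCategory Limits Pretriangulated

variable {S : Type*} [Ring S] {A : Type*} [Category* A] [Abelian A] [Linear S A]
  [HasDerivedCategory.{w} A]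

lemma map_eq_smul_id_of_iso {B D : Type*} [Category* B] [Category* D] [Preadditive D]
    [Linear S D] {F G : B ⥤ D} (e : F ≅ G) (x : S) {X : B} {f : X ⟶ X}
    (h : G.map f = x • 𝟙 _) : F.map f = x • 𝟙 _ := by
  rw [← NatIso.naturality_2 e f, h, Linear.smul_comp, Linear.comp_smul, Category.id_comp,
    Iso.hom_inv_id_app]

lemma homologyFunctor_map_smul_id (Y : DerivedCategory A) (x : S) (j : ℤ) :
    (homologyFunctor A j).map (x • 𝟙 Y) = x • 𝟙 _ := by
  obtain ⟨K, ⟨e⟩⟩ : ∃ K : CochainComplex A ℤ, Nonempty (Q.obj K ≅ Y) :=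
    ⟨_, ⟨Q.objObjPreimageIso Y⟩⟩
  have h1 : x • 𝟙 Y = e.inv ≫ Q.map (x • 𝟙 K) ≫ e.hom := by
    rw [Functor.map_smul, Q.map_id, Linear.smul_comp, Linear.comp_smul]
    simp
  have h2 : HomologicalComplex.homologyMap (x • 𝟙 K) j = x • 𝟙 _ := by
    have := ShortComplex.homologyMap_smul (𝟙 (K.sc j)) x
    rw [ShortComplex.homologyMap_id] at this
    exact this
  have h3 : (homologyFunctor A j).map (Q.map (x • 𝟙 K)) = x • 𝟙 _ := by
    exact map_eq_smul_id_of_iso (homologyFunctorFactors A j) x h2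
  rw [h1, Functor.map_comp, Functor.map_comp, h3, Linear.smul_comp, Linear.comp_smul,
    Category.id_comp, ← Functor.map_comp, e.inv_hom_id,
    (homologyFunctor A j).map_id]

variable {R : Type u} [CommRing R] [HasDerivedCategory.{w} (ModuleCat.{u} R)]

/-- The cohomology module in degree `j` of an object of the derived category. -/
abbrev derivedHomology (Y : DerivedCategory (ModuleCat.{u} R)) (j : ℤ) : ModuleCat.{u} R :=
  (homologyFunctor (ModuleCat.{u} R) j).obj Y

lemma homologyFunctor_map_smul_id_apply (Y : DerivedCategory (ModuleCat.{u} R)) (x : R) (j : ℤ)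
    (y : derivedHomology Y j) :
    ((homologyFunctor (ModuleCat.{u} R) j).map (x • 𝟙 Y)).hom y = x • y := by
  rw [homologyFunctor_map_smul_id]
  rfl

end Linear

/-! ### The cone of the multiplication by a ring element -/

section Modules

open IsLocalRing

variable {R : Type u} [CommRing R]

/-- If `φ` is surjective with kernel `x M`, its target is `M / x M`. -/
def quotSMulTopEquiv {M N : Type*} [AddCommGroup M] [Module R M] [AddCommGroup N] [Module R N]
    (x : R) (φ : M →ₗ[R] N) (hφ : Function.Surjective φ) (h₁ : ∀ m, φ (x • m) = 0)
    (h₂ : ∀ m, φ m = 0 → ∃ m', x • m' = m) : QuotSMulTop x M ≃ₗ[R] N :=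
  (Submodule.quotEquivOfEq _ _ (by
    ext m
    rw [Submodule.mem_smul_pointwise_iff_exists, LinearMap.mem_ker]
    constructor
    · rintro ⟨m', -, rfl⟩
      exact h₁ m'
    · intro h
      obtain ⟨m', h⟩ := h₂ m h
      exact ⟨m', trivial, h⟩)).trans (φ.quotKerEquivOfSurjective hφ)

/-- A nonzero finitely generated module has a nonzero map to any module with a nonzero element
killed by the maximal ideal: both involve the residue field. -/
lemma exists_linearMap_ne_zero [IsLocalRing R] (M N : Type*) [AddCommGroup M] [Module R M]
    [Module.Finite R M] [Nontrivial M] [AddCommGroup N] [Module R N] (x : N) (hx : x ≠ 0)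
    (hmx : ∀ r ∈ maximalIdeal R, r • x = 0) : ∃ φ : M →ₗ[R] N, φ ≠ 0 := by
  obtain ⟨S, hS, -⟩ := (eq_top_or_exists_le_coatom (⊥ : Submodule R M)).resolve_left bot_ne_top
  have : IsSimpleModule R (M ⧸ S) := isSimpleModule_iff_isCoatom.2 hS
  obtain ⟨I, hI, ⟨e⟩⟩ := isSimpleModule_iff_quot_maximal.1 this
  obtain rfl := eq_maximalIdeal hI
  let ψ : R ⧸ maximalIdeal R →ₗ[R] N :=
    (maximalIdeal R).liftQ (LinearMap.toSpanSingleton R N x) hmx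
  refine ⟨ψ ∘ₗ e.toLinearMap ∘ₗ S.mkQ, fun h => hx ?_⟩
  obtain ⟨m, hm⟩ := (e.surjective.comp S.mkQ_surjective) (Submodule.Quotient.mk 1)
  have := LinearMap.congr_fun h m
  change ψ (e (S.mkQ m)) = 0 at this
  rw [show e (S.mkQ m) = Submodule.Quotient.mk 1 from hm] at this
  rw [← one_smul R x]
  exact this

end Modules

section Cone

open DerivedCategory Limits Pretriangulated

variable {R : Type u} [CommRing R] [HasDerivedCategory.{w} (ModuleCat.{u} R)]
  {X Y Y' : DerivedCategory (ModuleCat.{u} R)} {x : R} {g : Y ⟶ Y'} {h : Y' ⟶ Y⟦(1 : ℤ)⟧}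
  (hT : Triangle.mk (x • 𝟙 Y) g h ∈ distTriang (DerivedCategory (ModuleCat.{u} R)))

/-- The connecting homomorphism attached to a triangle on the multiplication by `x`. -/
def coneδ (x : R) (g : Y ⟶ Y') (h : Y' ⟶ Y⟦(1 : ℤ)⟧) (j k : ℤ) (hjk : j + 1 = k) :
    derivedHomology Y' j →ₗ[R] derivedHomology Y k :=
  (HomologySequence.δ (Triangle.mk (x • 𝟙 Y) g h) j k hjk).hom

include hT

lemma cone_smul_comp_eq_zero : x • g = 0 := by
  have h1 : (x • 𝟙 Y) ≫ g = 0 := comp_distTriang_mor_zero₁₂ _ hT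
  rwa [Linear.smul_comp, Category.id_comp] at h1

lemma cone_comp_smul_eq_zero {W : DerivedCategory (ModuleCat.{u} R)} (f : W ⟶ Y') :
    x • (f ≫ h) = 0 := by
  have := comp_distTriang_mor_zero₃₁ _ hT
  have h1 : h ≫ (x • 𝟙 Y)⟦(1 : ℤ)⟧' = 0 := this
  rw [Functor.map_smul, (shiftFunctor _ (1 : ℤ)).map_id, Linear.comp_smul, Category.comp_id]
    at h1
  rw [← Linear.comp_smul, h1, comp_zero]

lemma cone_homology_map_smul (j : ℤ) (y : derivedHomology Y j) :
    ((homologyFunctor (ModuleCat.{u} R) j).map g).hom (x • y) = 0 := by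
  rw [← homologyFunctor_map_smul_id_apply, ← ModuleCat.comp_apply, ← Functor.map_comp,
    Linear.smul_comp, Category.id_comp, cone_smul_comp_eq_zero hT, Functor.map_zero]
  rfl

lemma cone_homology_exists_smul_eq (j : ℤ) (y : derivedHomology Y j)
    (hy : ((homologyFunctor (ModuleCat.{u} R) j).map g).hom y = 0) :
    ∃ y', x • y' = y := by
  obtain ⟨y', hy'⟩ := (ShortComplex.moduleCat_exact_iff _).1
    (HomologySequence.exact₂ _ hT j) y hy
  refine ⟨y', ?_⟩
  rw [← hy']
  exact (homologyFunctor_map_smul_id_apply Y x j y').symm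

lemma cone_homology_smul_δ (j k : ℤ) (hjk : j + 1 = k) (z : derivedHomology Y' j) :
    x • (coneδ x g h j k hjk) z = 0 := by
  refine (homologyFunctor_map_smul_id_apply Y x k _).symm.trans ?_
  exact congrArg (fun f => f.hom z) (HomologySequence.δ_comp _ hT j k hjk)

lemma cone_homology_exists_δ_eq (j k : ℤ) (hjk : j + 1 = k) (y : derivedHomology Y k)
    (hy : x • y = 0) :
    ∃ z, (coneδ x g h j k hjk) z = y :=
  (ShortComplex.moduleCat_exact_iff _).1 (HomologySequence.exact₁ _ hT j k hjk) y
    ((homologyFunctor_map_smul_id_apply Y x k _).trans hy)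

lemma cone_homology_exists_map_eq (j k : ℤ) (hjk : j + 1 = k) (z : derivedHomology Y' j)
    (hz : (coneδ x g h j k hjk) z = 0) :
    ∃ y, ((homologyFunctor (ModuleCat.{u} R) j).map g).hom y = z :=
  (ShortComplex.moduleCat_exact_iff _).1 (HomologySequence.exact₃ _ hT j k hjk) z hz

lemma cone_homology_subsingleton (j : ℤ) (h₁ : Subsingleton (derivedHomology Y j))
    (h₂ : Subsingleton (derivedHomology Y (j + 1))) : Subsingleton (derivedHomology Y' j) := by
  refine subsingleton_of_forall_eq 0 fun z => ?_
  obtain ⟨y, rfl⟩ := cone_homology_exists_map_eq hT j _ rfl z (Subsingleton.elim _ _)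
  rw [Subsingleton.elim y 0, map_zero]

lemma cone_homology_finite [IsNoetherianRing R]
    (hY : ∀ j, Module.Finite R (derivedHomology Y j)) (j : ℤ) :
    Module.Finite R (derivedHomology Y' j) := by
  have := hY
  have : IsNoetherian R (derivedHomology Y' j) :=
    isNoetherian_of_range_eq_ker ((homologyFunctor (ModuleCat.{u} R) j).map g).hom
    (coneδ x g h j (j + 1) rfl) (by
      ext z
      constructor
      · rintro ⟨y, rfl⟩
        exact congrArg (fun f => f.hom y) (HomologySequence.comp_δ _ hT j (j + 1) rfl)
      · exact cone_homology_exists_map_eq hT j (j + 1) rfl z)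
  infer_instance

lemma cone_homology_nilpotent {r : R}
    (hr : ∀ j, ∀ y : derivedHomology Y j, ∃ k : ℕ, r ^ k • y = 0)
    (j : ℤ) (z : derivedHomology Y' j) :
    ∃ k : ℕ, r ^ k • z = 0 := by
  obtain ⟨k, hk⟩ := hr (j + 1) ((coneδ x g h j _ rfl) z)
  rw [← map_smul] at hk
  obtain ⟨y, hy⟩ := cone_homology_exists_map_eq hT j _ rfl _ hk
  obtain ⟨l, hl⟩ := hr j y
  exact ⟨l + k, by rw [pow_add, mul_smul, ← hy, ← map_smul, hl, map_zero]⟩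

/-- Only the square of `x` need vanish, as the cohomology of the cone is an extension of two modules
killed by `x`. -/
lemma cone_homology_sq_smul (j : ℤ) (z : derivedHomology Y' j) : x ^ 2 • z = 0 := by
  have hk := cone_homology_smul_δ hT j _ rfl z
  rw [← map_smul] at hk
  obtain ⟨y, hy⟩ := cone_homology_exists_map_eq hT j _ rfl _ hk
  rw [pow_two, mul_smul, ← hy, ← map_smul, cone_homology_map_smul hT]

/-- The cohomology of the cone of the multiplication by `x` in the top degree is that of `Y`
modulo `x`. -/
def coneTopHomologyEquiv (t : ℤ) (hY : Subsingleton (derivedHomology Y (t + 1))) :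
    QuotSMulTop x (derivedHomology Y t) ≃ₗ[R] derivedHomology Y' t :=
  quotSMulTopEquiv x ((homologyFunctor (ModuleCat.{u} R) t).map g).hom
    (fun z => cone_homology_exists_map_eq hT t _ rfl z (Subsingleton.elim _ _))
    (cone_homology_map_smul hT t) (cone_homology_exists_smul_eq hT t)

/-- Morphisms to the cone of the multiplication by `x` are morphisms to `Y` modulo `x`, if
`Hom(X, Y⟦1⟧) = 0`. -/
def coneHomEquiv (hX : ∀ f : X ⟶ Y⟦(1 : ℤ)⟧, f = 0) : QuotSMulTop x (X ⟶ Y) ≃ₗ[R] (X ⟶ Y') :=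
  quotSMulTopEquiv x (Linear.rightComp R X g)
    (fun f => by
      obtain ⟨f', rfl⟩ := Triangle.coyoneda_exact₃ _ hT f (hX _)
      exact ⟨f', rfl⟩)
    (fun f => by
      change (x • f) ≫ g = 0
      rw [Linear.smul_comp, ← Linear.comp_smul, cone_smul_comp_eq_zero hT, comp_zero])
    (fun f hf => by
      obtain ⟨f', hf'⟩ : ∃ f' : X ⟶ Y, f = f' ≫ (x • 𝟙 Y) :=
        Triangle.coyoneda_exact₂ _ hT f hf
      refine ⟨f', ?_⟩
      rw [hf', Linear.comp_smul, Category.comp_id])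

omit hT in
lemma exists_shift_map_eq {i j : ℤ} (hij : i + 1 = j) (f : X⟦j⟧ ⟶ Y⟦(1 : ℤ)⟧) :
    ∃ f' : X⟦i⟧ ⟶ Y, f = (shiftFunctorAdd' _ i 1 j hij).hom.app X ≫ f'⟦(1 : ℤ)⟧' := by
  obtain ⟨f', hf'⟩ := (shiftFunctor (DerivedCategory (ModuleCat.{u} R)) (1 : ℤ)).map_surjective
    ((shiftFunctorAdd' _ i 1 j hij).inv.app X ≫ f)
  exact ⟨f', by rw [hf', Iso.hom_inv_id_app_assoc]⟩

omit hT in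
lemma hom_shift_eq_zero (hhom : ∀ j : ℤ, j ≠ 0 → ∀ f : X⟦j⟧ ⟶ Y, f = 0) {j : ℤ} (hj : j ≠ 1)
    (f : X⟦j⟧ ⟶ Y⟦(1 : ℤ)⟧) : f = 0 := by
  obtain ⟨f', rfl⟩ := exists_shift_map_eq (i := j - 1) (by ring) f
  rw [hhom (j - 1) (by omega) f', Functor.map_zero, comp_zero]

omit hT in
lemma hom_eq_zero_of_shift_zero (h0 : ∀ f : X⟦(0 : ℤ)⟧ ⟶ Y, f = 0) (f : X ⟶ Y) : f = 0 := by
  rw [← cancel_epi ((shiftFunctorZero _ ℤ).hom.app X), h0 (_ ≫ f), comp_zero]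

/-- The vanishing of morphisms from nonzero shifts of `X` passes to the cone of `x` on `Y` if `x`
is regular on `Hom(X, Y)`. -/
lemma cone_hom_eq_zero (hhom : ∀ j : ℤ, j ≠ 0 → ∀ f : X⟦j⟧ ⟶ Y, f = 0)
    (hx : ∀ f : X ⟶ Y, x • f = 0 → f = 0) (j : ℤ) (hj : j ≠ 0) (f : X⟦j⟧ ⟶ Y') : f = 0 := by
  have hf : f ≫ h = 0 := by
    by_cases h1 : j = 1
    · subst h1
      obtain ⟨f', hf'⟩ := exists_shift_map_eq (zero_add 1) (f ≫ h)
      have h2 := cone_comp_smul_eq_zero hT f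
      rw [hf', ← Linear.comp_smul, ← Functor.map_smul,
        Preadditive.IsIso.comp_left_eq_zero, Functor.map_eq_zero_iff] at h2
      have h3 := hx ((shiftFunctorZero _ ℤ).inv.app X ≫ f') (by
        rw [← Linear.comp_smul, h2, comp_zero])
      rw [Preadditive.IsIso.comp_left_eq_zero] at h3
      rw [hf', h3, Functor.map_zero, comp_zero]
    · exact hom_shift_eq_zero hhom h1 _
  obtain ⟨f', hf'⟩ : ∃ f' : X⟦j⟧ ⟶ Y, f = f' ≫ g := Triangle.coyoneda_exact₃ _ hT f hf
  rw [hf', hhom j hj f', zero_comp]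

end Cone

/-! ### Vanishing of cohomology below the top degree -/

section Amplitude

open DerivedCategory Limits Pretriangulated IsLocalRing RingTheory.Sequence

variable {R : Type u} [CommRing R] [IsNoetherianRing R] [IsLocalRing R]

/-- The hypothesis says that the support of `N` consists of the maximal ideal, which is therefore
associated to `N`. -/
lemma exists_ne_zero_maximalIdeal_smul_eq_zero (N : Type*) [AddCommGroup N] [Module R N]
    [Nontrivial N]
    (h : ∀ p : Ideal R, p.IsPrime → (∀ r, (∀ y : N, ∃ k : ℕ, r ^ k • y = 0) → r ∈ p) →
      p = maximalIdeal R) :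
    ∃ x : N, x ≠ 0 ∧ ∀ r ∈ maximalIdeal R, r • x = 0 := by
  obtain ⟨p, hp⟩ := associatedPrimes.nonempty R N
  obtain ⟨hp, x, rfl⟩ := isAssociatedPrime_iff.1 hp
  have hx : ∀ r : R, r ∈ (⊥ : Submodule R N).colon {x} ↔ r • x = 0 := fun r => by
    rw [Submodule.mem_colon_singleton, Submodule.mem_bot]
  refine ⟨x, fun h0 => hp.ne_top ((Ideal.eq_top_iff_one _).2 ((hx 1).2 (by rw [h0, smul_zero]))),
    fun r hr => (hx r).1 ?_⟩
  rw [h _ hp fun r hr => ?_]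
  · exact hr
  · obtain ⟨k, hk⟩ := hr x
    exact hp.mem_of_pow_mem k ((hx _).2 hk)

variable [HasDerivedCategory.{w} (ModuleCat.{u} R)]

omit [IsNoetherianRing R] in
/-- If the top cohomology of `X` is in degree `t`, the lowest one of `Y` in degree `u`, and all
morphisms from the shift of `X` with top cohomology in degree `u` to `Y` vanish, then the lowest
cohomology of `Y` has no socle. -/
lemma eq_zero_of_hom_eq_zero {X Y : DerivedCategory (ModuleCat.{u} R)} {t u : ℤ} [X.IsLE t]
    [Y.IsGE u] [Module.Finite R (derivedHomology X t)] [Nontrivial (derivedHomology X t)]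
    (hhom : ∀ f : X⟦t - u⟧ ⟶ Y, f = 0) (x : derivedHomology Y u)
    (hx : ∀ r ∈ maximalIdeal R, r • x = 0) : x = 0 := by
  by_contra hx0
  have h1 : (X⟦t - u⟧).IsLE u := TStructure.t.isLE_shift X t (t - u) u
  let e := homologyShiftIso X (t - u) u t (by ring)
  obtain ⟨φ, hφ⟩ := exists_linearMap_ne_zero (derivedHomology X t) _ x hx0 hx
  obtain ⟨f, hf⟩ := exists_homologyFunctor_map_eq u (e.hom ≫ ModuleCat.ofHom φ)
  rw [hhom f, Functor.map_zero] at hf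
  have h2 : ModuleCat.ofHom φ = 0 := by
    rw [← cancel_epi e.hom, ← hf, comp_zero]
  exact hφ (congrArg ModuleCat.Hom.hom h2)

/-- Let `X` have top cohomology in degree `t`, and suppose that all morphisms from nonzero shifts
of `X` to `Y` vanish and that `rs` is weakly regular on `Hom(X, Y)`. Then `Y` has no cohomology
below degree `t`, and if it has none above `t` either, `rs` is weakly regular on `H^t(Y)`.

The hypothesis `hsupp` says that the support of the cohomology of `Y` meets the zero locus of `rs`
in the maximal ideal only; it is stated with elements acting locally nilpotently because this passes
to the cone of the first element of `rs`, on which the induction proceeds. -/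
theorem cohomology_of_isWeaklyRegular {X : DerivedCategory (ModuleCat.{u} R)} {t : ℤ} [X.IsLE t]
    [Module.Finite R (derivedHomology X t)] [Nontrivial (derivedHomology X t)] (rs : List R)
    (hrs : ∀ r ∈ rs, r ∈ maximalIdeal R) (Y : DerivedCategory (ModuleCat.{u} R))
    (a : ℤ) (hbdd : ∀ j < a, Subsingleton (derivedHomology Y j))
    (hfin : ∀ j, Module.Finite R (derivedHomology Y j))
    (hhom : ∀ j : ℤ, j ≠ 0 → ∀ f : X⟦j⟧ ⟶ Y, f = 0)
    (hreg : IsWeaklyRegular (X ⟶ Y) rs)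
    (hsupp : ∀ p : Ideal R, p.IsPrime → (∀ r ∈ rs, r ∈ p) →
      (∀ r, (∀ j, ∀ y : derivedHomology Y j, ∃ k : ℕ, r ^ k • y = 0) → r ∈ p) →
      p = maximalIdeal R) :
    (∀ j < t, Subsingleton (derivedHomology Y j)) ∧
      ((∀ j > t, Subsingleton (derivedHomology Y j)) →
        IsWeaklyRegular (derivedHomology Y t) rs) := by
  induction rs generalizing Y a with
  | nil =>
    refine ⟨?_, fun _ => IsWeaklyRegular.nil _ _⟩
    by_contra! hcon
    obtain ⟨j₀, hj₀, hne⟩ := hcon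
    obtain ⟨v, hv, hmin⟩ := Int.exists_least_of_bdd (P := fun j => Nontrivial (derivedHomology Y j))
      ⟨a, fun j hj => by
        by_contra! hja
        exact not_subsingleton_iff_nontrivial.2 hj (hbdd j hja)⟩ ⟨j₀, hne⟩
    have hvt : v ≤ j₀ := hmin j₀ hne
    have hGE : Y.IsGE v := by
      rw [isGE_iff]
      intro j hj
      have : Subsingleton (derivedHomology Y j) := by
        by_contra hs
        exact absurd (hmin j (not_subsingleton_iff_nontrivial.1 hs)) (by omega)
      exact ModuleCat.isZero_of_subsingleton (derivedHomology Y j)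
    obtain ⟨x, hx0, hx⟩ := exists_ne_zero_maximalIdeal_smul_eq_zero (derivedHomology Y v)
      fun p hp hpn => hsupp p hp (by simp) fun r hr => hpn r (hr v)
    exact hx0 (eq_zero_of_hom_eq_zero (t := t) (hhom (t - v) (by omega)) x hx)
  | cons x rs ih =>
    obtain ⟨hx, hrs⟩ := List.forall_mem_cons.1 hrs
    obtain ⟨hxreg, hreg⟩ := (isWeaklyRegular_cons_iff _ _ _).1 hreg
    obtain ⟨Y', g, h, hT⟩ := distinguished_cocone_triangle (x • 𝟙 Y)
    have hxinj : ∀ f : X ⟶ Y, x • f = 0 → f = 0 := fun f hf =>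
      hxreg (hf.trans (smul_zero x).symm)
    have hX1 : ∀ f : X ⟶ Y⟦(1 : ℤ)⟧, f = 0 :=
      hom_eq_zero_of_shift_zero (hom_shift_eq_zero hhom zero_ne_one)
    obtain ⟨ih₁, ih₂⟩ := ih hrs Y' (a - 1)
      (fun j hj => cone_homology_subsingleton hT j (hbdd j (by omega)) (hbdd (j + 1) (by omega)))
      (cone_homology_finite hT hfin) (cone_hom_eq_zero hT hhom hxinj)
      (((coneHomEquiv hT hX1).isWeaklyRegular_congr rs).1 hreg)
      (fun p hp hp₁ hp₂ => hsupp p hp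
        (List.forall_mem_cons.2 ⟨hp₂ x fun j z => ⟨2, cone_homology_sq_smul hT j z⟩, hp₁⟩)
        fun r hr => hp₂ r (cone_homology_nilpotent hT hr))
    -- Below `t` the element `x` acts surjectively on the cohomology of `Y`.
    have hlow : ∀ j < t, Subsingleton (derivedHomology Y j) := fun j hj => by
      have := ih₁ j hj
      have := hfin j
      refine subsingleton_of_forall_eq 0 fun y => ?_
      have htop : (⊤ : Submodule R (derivedHomology Y j)) = ⊥ := by
        refine Submodule.eq_bot_of_le_smul_of_le_jacobson_bot (maximalIdeal R) ⊤
          Module.Finite.fg_top (fun y _ => ?_) (maximalIdeal_le_jacobson _)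
        obtain ⟨y', rfl⟩ := cone_homology_exists_smul_eq hT j y (Subsingleton.elim _ _)
        exact Submodule.smul_mem_smul hx trivial
      exact (Submodule.mem_bot R).1 (htop ▸ Submodule.mem_top)
    refine ⟨hlow, fun htop => (isWeaklyRegular_cons_iff _ _ _).2 ⟨?_, ?_⟩⟩
    · refine (isSMulRegular_iff_right_eq_zero_of_smul).2 fun y hy => ?_
      obtain ⟨z, rfl⟩ := cone_homology_exists_δ_eq hT (t - 1) t (by ring) y hy
      have := ih₁ (t - 1) (by omega)
      rw [Subsingleton.elim z 0, map_zero]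
    · refine ((coneTopHomologyEquiv hT t (htop _ (by omega))).isWeaklyRegular_congr rs).2
        (ih₂ fun j hj => ?_)
      exact cone_homology_subsingleton hT j (htop j hj) (htop (j + 1) (by omega))

end Amplitude

/-! ### Semidualizing complexes over Cohen-Macaulay rings -/

section CohenMacaulay

open IsLocalRing RingTheory.Sequence

variable {R : Type u} [CommRing R] [IsNoetherianRing R] [IsLocalRing R]

/-- A Cohen-Macaulay local ring has a regular sequence with Artinian quotient: by Rees' theorem the
vanishing of `Ext^i(k, R)` for `i < dim R` gives a regular sequence of length `dim R`, and each of
its elements lowers the dimension by one. -/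
lemma IsCohenMacaulayLocal.exists_isWeaklyRegular (h : IsCohenMacaulayLocal R) :
    ∃ rs : List R, (∀ r ∈ rs, r ∈ maximalIdeal R) ∧ IsWeaklyRegular R rs ∧
      IsArtinianRing (R ⧸ Ideal.ofList rs) := by
  obtain ⟨d, hd⟩ : ∃ d : ℕ, ringKrullDim R = d := by
    obtain ⟨d, hd⟩ := ENat.ne_top_iff_exists.1
      (show ringDepth R ≠ ⊤ from fun h0 => ringKrullDim_ne_top (R := R) (by rw [← h, h0]; rfl))
    exact ⟨d, by rw [← h, ← hd]; rfl⟩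
  have hdepth : ringDepth R = d := by
    rw [IsCohenMacaulayLocal, hd] at h
    exact WithBot.coe_injective h
  have hfin : Module.Finite R (ResidueField R) :=
    Module.Finite.of_surjective (Algebra.linearMap R (ResidueField R)) residue_surjective
  obtain ⟨rs, hlen, hrs, hreg⟩ := ModuleCat.exists_isRegular_of_exists_subsingleton_ext
    (maximalIdeal R) d (ModuleCat.of R R)
    (by
      rw [lt_top_iff_ne_top]
      exact maximalIdeal_smul_top_ne_top (R := R) R)
    (ModuleCat.of R (ResidueField R))
    (by
      rw [Module.support_eq_zeroLocus]
      exact congrArg (fun I : Ideal R => PrimeSpectrum.zeroLocus (I : Set R))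
        (Ideal.annihilator_quotient (I := maximalIdeal R)))
    (fun i hi => by
      by_contra hs
      have hs' := not_subsingleton_iff_nontrivial.1 hs
      have : ringDepth R ≤ i := iInf₂_le (i : ℕ) hs'
      rw [hdepth] at this
      exact absurd (Nat.cast_le.1 this) (by omega))
  have hreg' : IsRegular R rs := hreg
  refine ⟨rs, hrs, hreg'.toIsWeaklyRegular, ?_⟩
  have hdim := ringKrullDim_add_length_eq_ringKrullDim_of_isRegular rs hreg'
  rw [hd, hlen] at hdim
  rw [isArtinianRing_iff_krullDimLE_zero, Ring.krullDimLE_iff]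
  refine ((ENat.WithBot.add_natCast_cancel (c := d)).1 ?_).le
  rw [hdim]
  simp

end CohenMacaulay

section

open DerivedCategory IsLocalRing RingTheory.Sequence

variable {R : Type u} [CommRing R] [HasDerivedCategory.{w} (ModuleCat.{u} R)]

/-- The cohomology of a complex of modules agrees with the one in the derived category. -/
def derivedHomologyQIso (C : CochainComplex (ModuleCat.{u} R) ℤ) (j : ℤ) :
    derivedHomology (Q.obj C) j ≅ C.homology j :=
  (homologyFunctorFactors (ModuleCat.{u} R) j).app C

/-- The cohomology of a module placed in degree `t`. -/
def derivedHomologySingleIso (M : ModuleCat.{u} R) (t : ℤ) :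
    derivedHomology ((singleFunctor (ModuleCat.{u} R) t).obj M) t ≅ M :=
  (singleFunctorCompHomologyFunctorIso (ModuleCat.{u} R) t).app M

/-- A module in degree `t` is a shift of a module in degree zero. -/
def singleFunctorShiftIso (M : ModuleCat.{u} R) (s t : ℤ) (h : s + t = 0) :
    ((singleFunctor (ModuleCat.{u} R) 0).obj M)⟦s⟧ ≅ (singleFunctor (ModuleCat.{u} R) t).obj M :=
  ((singleFunctors (ModuleCat.{u} R)).shiftIso s t 0 h).app M

variable {C : CochainComplex (ModuleCat.{u} R) ℤ} [IsHomologicallyBounded C]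
  (hC : IsSemidualizing C)

include hC

/-- The endomorphism ring of a semidualizing complex is `R`, by the homothety morphism. -/
def IsSemidualizing.endEquiv : R ≃ₗ[R] (Q.obj C ⟶ Q.obj C) :=
  LinearEquiv.ofBijective (LinearMap.toSpanSingleton R _ (𝟙 (Q.obj C)))
    ⟨(injective_iff_map_eq_zero _).2 fun r hr => hC.eq_zero_of_smul_id_eq_zero r hr,
      fun f => (hC.exists_smul_id_eq f).imp fun _ h => h.symm⟩

lemma IsSemidualizing.hom_shift_eq_zero {j : ℤ} (hj : j ≠ 0) (f : (Q.obj C)⟦j⟧ ⟶ Q.obj C) :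
    f = 0 := by
  refine (shiftFunctor (DerivedCategory (ModuleCat.{u} R)) (-j)).map_injective ?_
  rw [Functor.map_zero, ← cancel_epi ((shiftFunctorCompIsoId _ j (-j) (by simp)).inv.app (Q.obj C)),
    Limits.comp_zero]
  exact hC.shiftedHom_eq_zero (neg_ne_zero.2 hj) _

lemma IsSemidualizing.finite_derivedHomology (j : ℤ) :
    Module.Finite R (derivedHomology (Q.obj C) j) := by
  have h := hC.finite_homology (-j)
  have e : lowerHomology C (-j) ≅ derivedHomology (Q.obj C) j :=
    eqToIso (congrArg (fun i => C.homology i) (neg_neg j)) ≪≫ (derivedHomologyQIso C j).symm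
  exact Module.Finite.equiv e.toLinearEquiv

lemma IsSemidualizing.exists_nontrivial_top [Nontrivial R] :
    ∃ t : ℤ, Nontrivial (derivedHomology (Q.obj C) t) ∧ (Q.obj C).IsLE t := by
  obtain ⟨b, hb⟩ := IsHomologicallyBounded.exists_isLE (X := C)
  have hb' : (Q.obj C).IsLE b := inferInstance
  have hsub : ∀ j, ¬ Nontrivial (derivedHomology (Q.obj C) j) →
      Limits.IsZero (derivedHomology (Q.obj C) j) := fun j hj => by
    have := not_nontrivial_iff_subsingleton.1 hj
    exact ModuleCat.isZero_of_subsingleton _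
  obtain ⟨t, ht, hmax⟩ := Int.exists_greatest_of_bdd
    (P := fun j => Nontrivial (derivedHomology (Q.obj C) j))
    ⟨b, fun j hj => by
      by_contra! hjb
      have := ModuleCat.subsingleton_of_isZero ((Q.obj C).isZero_of_isLE b j hjb)
      exact not_subsingleton_iff_nontrivial.2 hj this⟩ (by
      by_contra! hall
      have hid : 𝟙 (Q.obj C) = 0 := by
        have h1 : (Q.obj C).IsLE 0 := (isLE_iff _ _).2 fun j _ =>
          ModuleCat.isZero_of_subsingleton (derivedHomology (Q.obj C) j)
        have h2 : (Q.obj C).IsGE 1 := (isGE_iff _ _).2 fun j _ =>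
          ModuleCat.isZero_of_subsingleton (derivedHomology (Q.obj C) j)
        exact TStructure.t.zero _ 0 1
      exact one_ne_zero (hC.eq_zero_of_smul_id_eq_zero 1 (by rw [hid, smul_zero])))
  refine ⟨t, ht, (isLE_iff _ _).2 fun j hj => hsub j fun h => ?_⟩
  exact absurd (hmax j h) (by omega)

/-- Over a local ring with a regular sequence which generates an ideal primary to the maximal ideal,
a semidualizing complex is a shift of a module, and the sequence is regular on this module. -/
theorem IsSemidualizing.exists_iso_shift_of_isWeaklyRegular [IsNoetherianRing R] [IsLocalRing R]
    {rs : List R}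
    (hrs : ∀ r ∈ rs, r ∈ maximalIdeal R) (hreg : IsWeaklyRegular R rs)
    (hart : IsArtinianRing (R ⧸ Ideal.ofList rs)) :
    ∃ (M : ModuleCat.{u} R) (s : ℤ), Module.Finite R M ∧ IsWeaklyRegular M rs ∧
      Nonempty (Q.obj C ≅ ((singleFunctor (ModuleCat.{u} R) 0).obj M)⟦s⟧) := by
  obtain ⟨t, ht, hLE⟩ := hC.exists_nontrivial_top
  have hfin := hC.finite_derivedHomology
  obtain ⟨a, ha⟩ := IsHomologicallyBounded.exists_isGE (X := C)
  have ha' : (Q.obj C).IsGE a := inferInstance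
  obtain ⟨hlow, htop⟩ := cohomology_of_isWeaklyRegular (X := Q.obj C) (t := t) rs hrs (Q.obj C) a
    (fun j hj => ModuleCat.subsingleton_of_isZero ((Q.obj C).isZero_of_isGE a j hj)) hfin
    (fun j hj f => hC.hom_shift_eq_zero hj f) ((hC.endEquiv.isWeaklyRegular_congr rs).1 hreg)
    (fun p hp hrsp _ => by
      have hle : Ideal.ofList rs ≤ p := Ideal.span_le.2 hrsp
      have : IsArtinianRing (R ⧸ p) := (Ideal.Quotient.factor_surjective hle).isArtinianRing
      exact eq_maximalIdeal (Ideal.Quotient.maximal_of_isField p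
        (IsArtinianRing.isField_of_isDomain (R ⧸ p))))
  have hGE : (Q.obj C).IsGE t := (isGE_iff _ _).2 fun j hj =>
    have := hlow j hj
    ModuleCat.isZero_of_subsingleton (derivedHomology (Q.obj C) j)
  obtain ⟨M, ⟨e⟩⟩ := exists_iso_singleFunctor_obj_of_isGE_of_isLE (Q.obj C) t
  let e' : derivedHomology (Q.obj C) t ≃ₗ[R] M :=
    ((homologyFunctor (ModuleCat.{u} R) t).mapIso e ≪≫ derivedHomologySingleIso M t).toLinearEquiv
  refine ⟨M, -t, Module.Finite.equiv e', (e'.isWeaklyRegular_congr rs).1 (htop fun j hj => ?_),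
    ⟨e ≪≫ (singleFunctorShiftIso M (-t) t (by simp)).symm⟩⟩
  exact ModuleCat.subsingleton_of_isZero ((Q.obj C).isZero_of_isLE t j hj)

end

/-! ### The dual of a resolution of a semidualizing module -/

section DualComplex

open DerivedCategory

variable {R : Type u} [CommRing R] [HasDerivedCategory.{w} (ModuleCat.{u} R)]
  {C : CochainComplex (ModuleCat.{u} R) ℤ} [IsHomologicallyBounded C]
  (hC : IsSemidualizing C) {M : ModuleCat.{u} R} {s : ℤ}
  (e : Q.obj C ≅ ((singleFunctor (ModuleCat.{u} R) 0).obj M)⟦s⟧)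

include hC e

lemma IsSemidualizing.ext_eq_zero {i : ℕ} (hi : i ≠ 0) (α : Abelian.Ext.{u} M M i) : α = 0 := by
  refine Abelian.Ext.ext ?_
  rw [Abelian.Ext.zero_hom]
  refine (shiftFunctor (DerivedCategory (ModuleCat.{u} R)) s).map_injective ?_
  rw [Functor.map_zero, ← cancel_epi e.hom, Limits.comp_zero,
    ← cancel_mono ((shiftComm _ (i : ℤ) s).hom ≫ e.inv⟦(i : ℤ)⟧'), Limits.zero_comp]
  exact hC.shiftedHom_eq_zero (by exact_mod_cast hi) _

/-- Every endomorphism of a semidualizing module is a homothety. -/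
lemma IsSemidualizing.exists_eq_smul (ψ : M →ₗ[R] M) : ∃ r : R, ∀ m, ψ m = r • m := by
  obtain ⟨r, hr⟩ := hC.exists_smul_id_eq
    (e.hom ≫ ((singleFunctor (ModuleCat.{u} R) 0).map (ModuleCat.ofHom ψ))⟦s⟧' ≫ e.inv)
  have h : ModuleCat.ofHom ψ = r • 𝟙 M := by
    refine (singleFunctor (ModuleCat.{u} R) 0).map_injective
      ((shiftFunctor (DerivedCategory (ModuleCat.{u} R)) s).map_injective ?_)
    rw [← cancel_epi e.hom, ← cancel_mono e.inv, Category.assoc, hr, Functor.map_smul,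
      Functor.map_smul, (singleFunctor (ModuleCat.{u} R) 0).map_id,
      (shiftFunctor (DerivedCategory (ModuleCat.{u} R)) s).map_id, Linear.comp_smul,
      Linear.smul_comp, Category.comp_id, e.hom_inv_id]
  exact ⟨r, fun m => congrArg (fun f => f.hom m) h⟩

/-- A semidualizing module is faithful. -/
lemma IsSemidualizing.eq_zero_of_smul_eq_zero (r : R) (hr : ∀ m : M, r • m = 0) : r = 0 := by
  refine hC.eq_zero_of_smul_id_eq_zero r ?_
  have h : r • 𝟙 M = 0 := by
    ext m
    exact hr m
  have h' : r • 𝟙 (((singleFunctor (ModuleCat.{u} R) 0).obj M)⟦s⟧) = 0 := by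
    have := congrArg (fun f => ((singleFunctor (ModuleCat.{u} R) 0).map f)⟦s⟧') h
    rwa [Functor.map_smul, Functor.map_smul, (singleFunctor (ModuleCat.{u} R) 0).map_id,
      (shiftFunctor (DerivedCategory (ModuleCat.{u} R)) s).map_id, Functor.map_zero,
      Functor.map_zero] at this
  rw [← cancel_mono e.hom, Linear.smul_comp, Category.id_comp, ← Category.comp_id e.hom,
    ← Linear.comp_smul, h', Limits.comp_zero, Limits.zero_comp]

/-- The complex `Hom(P, M)` is exact in positive degrees, since it computes the groups
`Ext^i(M, M) = 0`. -/
lemma IsSemidualizing.exact_lcomp_d (P : ProjectiveResolution M) (i : ℕ) :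
    Function.Exact ((P.complex.d (i + 1) i).hom.lcomp R M)
      ((P.complex.d (i + 2) (i + 1)).hom.lcomp R M) := by
  intro φ
  constructor
  · intro hφ
    have hφ' : P.complex.d (i + 2) (i + 1) ≫ ModuleCat.ofHom φ = 0 := ModuleCat.hom_ext hφ
    obtain ⟨g, hg⟩ := (P.extMk_eq_zero_iff (ModuleCat.ofHom φ) (i + 2) rfl hφ' i rfl).1
      (hC.ext_eq_zero e i.succ_ne_zero _)
    exact ⟨g.hom, congrArg ModuleCat.Hom.hom hg⟩
  · rintro ⟨g, rfl⟩
    have := P.complex.d_comp_d (i + 2) (i + 1) i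
    ext x
    have h := congrArg (fun f => g (f.hom x)) this
    exact h.trans (map_zero g)

end DualComplex

section Augmentation

variable {R : Type u} [CommRing R] {M : ModuleCat.{u} R} (P : ProjectiveResolution M)

/-- The augmentation of a projective resolution of a module. -/
def augmentation : P.complex.X 0 →ₗ[R] M := (P.π.f 0).hom

lemma augmentation_surjective : Function.Surjective (augmentation P) :=
  (ModuleCat.epi_iff_surjective (P.π.f 0)).1 inferInstance

lemma exact_augmentation : Function.Exact (P.complex.d 1 0).hom (augmentation P) :=
  (ShortComplex.ShortExact.moduleCat_exact_iff_function_exact _).1 P.exact₀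

lemma exact_resolution_d (i : ℕ) :
    Function.Exact (P.complex.d (i + 2) (i + 1)).hom (P.complex.d (i + 1) i).hom :=
  (ShortComplex.ShortExact.moduleCat_exact_iff_function_exact _).1 (P.exact_succ i)

open DerivedCategory

variable [HasDerivedCategory.{w} (ModuleCat.{u} R)]
  {C : CochainComplex (ModuleCat.{u} R) ℤ} [IsHomologicallyBounded C]
  (hC : IsSemidualizing C) {s : ℤ}
  (e : Q.obj C ≅ ((singleFunctor (ModuleCat.{u} R) 0).obj M)⟦s⟧)

include hC e

lemma IsSemidualizing.injective_toSpanSingleton_augmentation :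
    Function.Injective (LinearMap.toSpanSingleton R (P.complex.X 0 →ₗ[R] M) (augmentation P)) := by
  refine (injective_iff_map_eq_zero _).2 fun r hr => hC.eq_zero_of_smul_eq_zero e r fun m => ?_
  obtain ⟨x, rfl⟩ := augmentation_surjective P m
  exact LinearMap.congr_fun hr x

lemma IsSemidualizing.exact_toSpanSingleton_augmentation :
    Function.Exact (LinearMap.toSpanSingleton R (P.complex.X 0 →ₗ[R] M) (augmentation P))
      ((P.complex.d 1 0).hom.lcomp R M) := by
  intro φ
  constructor
  · intro hφ
    have hker : LinearMap.ker (augmentation P) ≤ LinearMap.ker φ := by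
      intro x hx
      obtain ⟨y, rfl⟩ := (exact_augmentation P x).1 hx
      exact LinearMap.congr_fun hφ y
    obtain ⟨r, hr⟩ := hC.exists_eq_smul e ((LinearMap.ker (augmentation P)).liftQ φ hker ∘ₗ
      ((augmentation P).quotKerEquivOfSurjective (augmentation_surjective P)).symm.toLinearMap)
    refine ⟨r, LinearMap.ext fun x => ?_⟩
    refine (hr (augmentation P x)).symm.trans ?_
    have h1 : ((augmentation P).quotKerEquivOfSurjective (augmentation_surjective P)).symm
        (augmentation P x) = Submodule.Quotient.mk x := by
      rw [LinearEquiv.symm_apply_eq]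
      rfl
    rw [LinearMap.comp_apply, LinearEquiv.coe_coe, h1]
    rfl
  · rintro ⟨r, rfl⟩
    ext y
    change r • augmentation P ((P.complex.d 1 0).hom y) = 0
    rw [(exact_augmentation P).apply_apply_eq_zero, smul_zero]

end Augmentation

/-! ### Conclusion -/

section Conclusion

open DerivedCategory IsLocalRing

variable {R : Type u} [CommRing R] [HasDerivedCategory.{w} (ModuleCat.{u} R)]
  {C : CochainComplex (ModuleCat.{u} R) ℤ}

/-- A complex isomorphic to `Σ^n R` has supremum `n`. -/
lemma complexSup_eq_of_iso [Nontrivial R] {n : ℤ}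
    (e : Q.obj C ≅ ((singleFunctor (ModuleCat.{u} R) 0).obj (ModuleCat.of R R))⟦n⟧) :
    ((n : WithTop ℤ) : WithBot (WithTop ℤ)) = complexSup C := by
  let e' := e ≪≫ singleFunctorShiftIso (ModuleCat.of R R) n (-n) (by simp)
  let f (j : ℤ) := (derivedHomologyQIso C j).symm ≪≫ (homologyFunctor (ModuleCat.{u} R) j).mapIso e'
  have h : ∀ i : ℤ, ¬ Limits.IsZero (lowerHomology C i) ↔ i = n := by
    intro i
    rw [(f (-i)).isZero_iff]
    refine ⟨fun h => ?_, ?_⟩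
    · by_contra hi
      refine h ?_
      rcases lt_or_gt_of_ne hi with hi | hi
      · exact isZero_of_isLE _ (-n) (-i) (by omega)
      · exact isZero_of_isGE _ (-n) (-i) (by omega)
    · rintro rfl h0
      have h1 : Limits.IsZero (ModuleCat.of R R) :=
        h0.of_iso (derivedHomologySingleIso (ModuleCat.of R R) (-i)).symm
      exact not_subsingleton R (ModuleCat.subsingleton_of_isZero h1)
  have hs : {s : WithBot (WithTop ℤ) | ∃ i : ℤ, ¬ Limits.IsZero (lowerHomology C i) ∧
      s = ((i : WithTop ℤ) : WithBot _)} = {((n : WithTop ℤ) : WithBot (WithTop ℤ))} := by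
    ext s
    simp [h]
  rw [complexSup, hs, csSup_singleton]

variable [IsLocalRing R] [IsHomologicallyBounded C] (hC : IsSemidualizing C) {M : ModuleCat.{u} R}
  {s : ℤ}
  (e : Q.obj C ≅ ((singleFunctor (ModuleCat.{u} R) 0).obj M)⟦s⟧)
  (P : ProjectiveResolution M)
  (hfree : ∀ i, Module.Free R (P.complex.X i))

include hC e hfree in
/-- If the free cover of `M` has rank one, then `M` is cyclic; being faithful, it is isomorphic
to `R`. -/
lemma IsSemidualizing.nonempty_iso_of_finrank_eq_one (h : Module.finrank R (P.complex.X 0) = 1) :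
    Nonempty (M ≅ ModuleCat.of R R) := by
  have := hfree 0
  have : Module.Finite R (P.complex.X 0) := Module.finite_of_finrank_pos (by omega)
  let f : R ≃ₗ[R] P.complex.X 0 := LinearEquiv.ofFinrankEq _ _ (by rw [Module.finrank_self, h])
  let g : R →ₗ[R] M := augmentation P ∘ₗ f.toLinearMap
  have hg : Function.Surjective g := (augmentation_surjective P).comp f.surjective
  have hg' : Function.Injective g := (injective_iff_map_eq_zero g).2 fun r hr =>
    hC.eq_zero_of_smul_eq_zero e r fun m => by
      obtain ⟨a, rfl⟩ := hg m
      rw [← map_smul, smul_eq_mul, mul_comm, ← smul_eq_mul, map_smul, hr, smul_zero]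
  exact ⟨(LinearEquiv.ofBijective g ⟨hg', hg⟩).symm.toModuleIso⟩

include hC e hfree in
/-- If no free module in positive degrees of a minimal resolution of `M` has rank one, a Betti
number equal to one is that of degree `s`, and `M ≅ R`. -/
lemma IsSemidualizing.iso_shift_and_eq_complexSup
    (hmin : ∀ i, LinearMap.range (P.complex.d (i + 1) i).hom ≤ maximalIdeal R • ⊤)
    (hne : ∀ i, Module.finrank R (P.complex.X (i + 1)) ≠ 1) {n : ℤ} (hn : betti C n = 1) :
    Nonempty (Q.obj C ≅
      ((singleFunctor (ModuleCat.{u} R) 0).obj (ModuleCat.of R R))⟦n⟧) ∧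
    ((n : WithTop ℤ) : WithBot (WithTop ℤ)) = complexSup C := by
  have hns : s ≤ n := by
    by_contra! h
    rw [betti_eq_zero C P hmin e n h] at hn
    exact zero_ne_one hn
  obtain ⟨i, hi⟩ : ∃ i : ℕ, n = i + s := ⟨(n - s).toNat, by omega⟩
  rw [hi, betti_eq_finrank C P hmin e hfree] at hn
  obtain rfl : i = 0 := by
    rcases i with _ | i
    · rfl
    · exact absurd hn (hne i)
  obtain rfl : n = s := by simpa using hi
  obtain ⟨f⟩ := hC.nonempty_iso_of_finrank_eq_one e P hfree hn
  have e' : Q.obj C ≅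
      ((singleFunctor (ModuleCat.{u} R) 0).obj (ModuleCat.of R R))⟦n⟧ :=
    e ≪≫ (shiftFunctor _ n).mapIso ((singleFunctor (ModuleCat.{u} R) 0).mapIso f)
  exact ⟨⟨e'⟩, complexSup_eq_of_iso e'⟩

end Conclusion

end SemidualizingBetti

end

theorem theorem2p17 {R : Type u} [CommRing R] [IsNoetherianRing R] [IsLocalRing R]
    [HasDerivedCategory.{w} (ModuleCat.{u} R)]
    (C : CochainComplex (ModuleCat.{u} R) ℤ) [SemidualizingBetti.IsHomologicallyBounded C]
    (hC : SemidualizingBetti.IsSemidualizing C) (n : ℤ) (hn : SemidualizingBetti.betti C n = 1)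
    (h : SemidualizingBetti.IsCohenMacaulayLocal R ∨
      ∃ M : ModuleCat.{u} R, SemidualizingBetti.HasRank R M ∧
        Nonempty (DerivedCategory.Q.obj C ≅
          (DerivedCategory.singleFunctor (ModuleCat.{u} R) 0).obj M)) :
    Nonempty (DerivedCategory.Q.obj C ≅
      ((DerivedCategory.singleFunctor (ModuleCat.{u} R) 0).obj (ModuleCat.of R R))⟦n⟧) ∧
    ((n : WithTop ℤ) : WithBot (WithTop ℤ)) = SemidualizingBetti.complexSup C := by
  rcases h with hCM | ⟨M, hM, ⟨e⟩⟩
  · obtain ⟨rs, hrs, hreg, hart⟩ := hCM.exists_isWeaklyRegular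
    obtain ⟨M, s, hfin, hregM, ⟨e⟩⟩ := hC.exists_iso_shift_of_isWeaklyRegular hrs hreg hart
    obtain ⟨P, hfree, hfinite, hmin⟩ := SemidualizingBetti.exists_minimal_projectiveResolution M
    exact hC.iso_shift_and_eq_complexSup e P hfree hmin (fun i =>
      SemidualizingBetti.finrank_ne_one_of_isArtinian_quotient
        (F := fun i => P.complex.X i) (M := M)
        (fun i => (P.complex.d (i + 1) i).hom) (SemidualizingBetti.augmentation P)
        (SemidualizingBetti.augmentation_surjective P) (SemidualizingBetti.exact_augmentation P)
        (SemidualizingBetti.exact_resolution_d P) hmin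
        (hC.injective_toSpanSingleton_augmentation P e)
        (hC.exact_toSpanSingleton_augmentation P e) (hC.exact_lcomp_d e P) hrs hreg hregM i) hn
  · have hfin : Module.Finite R M :=
      have := hC.finite_derivedHomology 0
      Module.Finite.equiv ((DerivedCategory.homologyFunctor (ModuleCat.{u} R) 0).mapIso e ≪≫
        SemidualizingBetti.derivedHomologySingleIso M 0).toLinearEquiv
    let e' := e ≪≫ ((shiftFunctorZero (DerivedCategory (ModuleCat.{u} R)) ℤ).symm.app _)
    have hnt : Nontrivial M := by
      by_contra hM0
      have := not_nontrivial_iff_subsingleton.1 hM0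
      exact one_ne_zero (hC.eq_zero_of_smul_eq_zero e' (1 : R) fun m => Subsingleton.elim _ _)
    obtain ⟨P, hfree, hfinite, hmin⟩ := SemidualizingBetti.exists_minimal_projectiveResolution M
    exact hC.iso_shift_and_eq_complexSup e' P hfree hmin (fun i =>
      SemidualizingBetti.finrank_ne_one_of_hasRank
      (F := fun i => P.complex.X i) (M := M)
      (fun i => (P.complex.d (i + 1) i).hom) (SemidualizingBetti.augmentation P)
      (SemidualizingBetti.augmentation_surjective P) (SemidualizingBetti.exact_augmentation P)
      (SemidualizingBetti.exact_resolution_d P) hmin (hC.exact_lcomp_d e' P) hM i) hn
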